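/- **Theorem 1.** Let $\mathcal H\subseteq 2^V$ be a hypergraph with $n=|V|$ vertices and $m=|\mathcal H|$ edges, and let every vertex $v$ have a list $\mathcal L(v)\subseteq[k]$ of admissible colors. A proper $\mathcal L$-coloring is a map $\chi:V\to[k]$ with $\chi(v)\in\mathcal L(v)$ for all $v\in V$ and $|\chi(H)|\ge 2$ for all $H\in\mathcal H$. The hypergraph is $c$-intersecting if every $H\in\mathcal H$ is disjoint from at most $c$ edges of $\mathcal H$. The problem Proper-$\mathcal L$-Coloring is to find, given $(\mathcal H,\mathcal L)$, a proper $\mathcal L$-coloring of $\mathcal H$, or to declare correctly that none exists. There is a deterministic recursive algorithm for this problem with the following property. For every constant $k$ and every function $c(m,n)\le\operatorname{polylog}(m,n)$ there are bounds $T(m,n)=2^{\operatorname{polylog}(m,n)}$, $D(m,n)=\operatorname{polylog}(m,n)$ and $W(m,n)=\operatorname{poly}(m,n)$ such that, on every $c(m,n)$-intersecting hypergraph with $n$ vertices and $m$ edges and all lists $\mathcal L(v)\subseteq[k]$, the algorithm halts with a correct result within $T(m,n)$ steps, its recursion tree has depth at most $D(m,n)$, and each single recursive call spends at most $W(m,n)$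 steps outside the calls that it makes. The algorithm is a backtracking procedure: a call on a subproblem either returns a solution, or computes a list of subproblems, calls itself on them in turn, and returns the first solution found, if any. Here a function is $\operatorname{polylog}(m,n)$ if it is at most $C(\log_2(m+n+2))^a$, and $\operatorname{poly}(m,n)$ if it is at most $C(m+n+2)^a$, for some constants $C,a$. -/

import Mathlib

/-! ### Hypergraphs and proper list colorings -/

/-- A hypergraph `H` (a finite set of edges) is `c`-intersecting if every edge is disjoint from at
most `c` edges of `H`. -/
def IsCIntersecting {V : Type*} [DecidableEq V] (c : ℕ) (H : Finset (Finset V)) : Prop :=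
  ∀ E ∈ H, (H.filter fun E' => E ∩ E' = ∅).card ≤ c

/-- `χ` takes its colors from the lists `L`, and every edge receives at least two colors. -/
def IsProperListColoring {V : Type*} [DecidableEq V] {k : ℕ} (H : Finset (Finset V))
    (L : V → Finset (Fin k)) (χ : V → Fin k) : Prop :=
  (∀ v, χ v ∈ L v) ∧ ∀ E ∈ H, 2 ≤ (E.image χ).card

/-! ### Growth rates in two parameters -/

/-- `f(m,n) ≤ C (m+n+2)^a` for some constants `C`, `a`. -/
def IsPolyBounded (f : ℕ → ℕ → ℕ) : Prop :=
  ∃ C a : ℕ, ∀ m n, f m n ≤ C * (m + n + 2) ^ a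

/-- `f(m,n) ≤ C (log₂ (m+n+2))^a` for some constants `C`, `a`. -/
def IsPolylogBounded (f : ℕ → ℕ → ℕ) : Prop :=
  ∃ C a : ℕ, ∀ m n, f m n ≤ C * (Nat.log 2 (m + n + 2)) ^ a

/-- `f(m,n) ≤ 2 ^ (C (log₂ (m+n+2))^a)` for some constants `C`, `a`. -/
def IsQuasiPolyBounded (f : ℕ → ℕ → ℕ) : Prop :=
  ∃ C a : ℕ, ∀ m n, f m n ≤ 2 ^ (C * (Nat.log 2 (m + n + 2)) ^ a)

/-! ### Data: binary trees (S-expressions), handled by pointers -/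

/-- The values that programs compute with. -/
inductive Data : Type
  | nil : Data
  | cons : Data → Data → Data

namespace Data

/-- First component (`nil` for `nil`). -/
def head : Data → Data
  | nil => nil
  | cons a _ => a

/-- Second component (`nil` for `nil`). -/
def tail : Data → Data
  | nil => nil
  | cons _ b => b

/-- The elements of a tree read as a `nil`-terminated list. -/
def spine : Data → List Data
  | nil => []
  | cons a b => a :: b.spine

/-- A list as a tree. -/
def ofList : List Data → Data
  | [] => nil
  | a :: l => cons a (ofList l)

/-- A bit as a tree. -/
def ofBool : Bool → Data
  | false => nil
  | true => cons nil nil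

/-- A natural number in unary. -/
def ofNat (j : ℕ) : Data := ofList (List.replicate j nil)

/-- A subset of `{0, …, n-1}` as its characteristic vector of length `n`. -/
def ofFinset {n : ℕ} (s : Finset (Fin n)) : Data :=
  ofList (List.ofFn fun v => ofBool (decide (v ∈ s)))

end Data

/-- The input: the edges in the order in which they are listed, and the list of every vertex, all
of them as characteristic vectors. -/
def encodeInput {n k : ℕ} (es : List (Finset (Fin n))) (L : Fin n → Finset (Fin k)) : Data :=
  .cons (.ofList (es.map Data.ofFinset)) (.ofList (List.ofFn fun v => Data.ofFinset (L v)))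

/-- A coloring as the list of the colors (in unary) of the vertices. -/
def encodeColoring {n k : ℕ} (χ : Fin n → Fin k) : Data :=
  .ofList (List.ofFn fun v => Data.ofNat (χ v : ℕ))

/-! ### Programs for procedure bodies, with a step count

A first-order language over trees whose only loop runs through the elements of a list. Variables
are de Bruijn indices into an environment. Every operation is a constant number of pointer
operations and costs one step. -/

/-- Programs. -/
inductive Prog : Type
  | var : ℕ → Prog
  | nil : Prog
  | cons : Prog → Prog → Prog
  | head : Prog → Prog
  | tail : Prog → Prog
  /-- `ite c a b`: `b` if the value of `c` is `nil`, and `a` otherwise -/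
  | ite : Prog → Prog → Prog → Prog
  /-- `bind a b`: `b` with the value of `a` as the new variable `0` -/
  | bind : Prog → Prog → Prog
  /-- `fold l a b`: start with the accumulator `a`; for each element of the list `l`, in order,
  replace the accumulator by the value of `b`, where variable `0` is the accumulator and
  variable `1` the element -/
  | fold : Prog → Prog → Prog → Prog

/-- The value of a program in an environment, and the number of steps of its evaluation. -/
def Prog.eval : Prog → List Data → Data × ℕ
  | .var i, ρ => (ρ.getD i .nil, 1)
  | .nil, _ => (.nil, 1)
  | .cons a b, ρ =>
      (.cons (a.eval ρ).1 (b.eval ρ).1, (a.eval ρ).2 + (b.eval ρ).2 + 1)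
  | .head a, ρ => ((a.eval ρ).1.head, (a.eval ρ).2 + 1)
  | .tail a, ρ => ((a.eval ρ).1.tail, (a.eval ρ).2 + 1)
  | .ite c a b, ρ =>
      match (c.eval ρ).1 with
      | .nil => ((b.eval ρ).1, (c.eval ρ).2 + (b.eval ρ).2 + 1)
      | .cons _ _ => ((a.eval ρ).1, (c.eval ρ).2 + (a.eval ρ).2 + 1)
  | .bind a b, ρ =>
      ((b.eval ((a.eval ρ).1 :: ρ)).1, (a.eval ρ).2 + (b.eval ((a.eval ρ).1 :: ρ)).2 + 1)
  | .fold l a b, ρ =>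
      (l.eval ρ).1.spine.foldl
        (fun s x => ((b.eval (s.1 :: x :: ρ)).1, s.2 + (b.eval (s.1 :: x :: ρ)).2 + 1))
        ((a.eval ρ).1, (l.eval ρ).2 + (a.eval ρ).2 + 1)

/-! ### Recursive backtracking procedures

A recursive procedure is given by its body, a program `p`. Called on an argument `x`, it evaluates
`p` on `x` and then, according to the value, either stops with a solution, or calls itself on each
of a list of subproblems in turn. It returns the first solution that one of these calls returns;
if there is none (in particular if there are no subproblems), it returns without a solution. -/

/-- What a call does after its body has been evaluated. -/
inductive CallAction : Type
  | answer : Data → CallAction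
  | branch : List Data → CallAction

/-- A tree with first component `nil` is a solution, the second component; otherwise the second
component is the list of subproblems. -/
def Data.action : Data → CallAction
  | .cons .nil s => .answer s
  | d => .branch d.tail.spine

/-- The resources used by a call together with everything below it in the recursion tree:
the total number of steps (`time`), the height of its recursion tree (`depth`), and the largest
number of steps that a single call in this tree spends outside its recursive calls
(`nodeTime`). -/
structure Cost : Type where
  time : ℕ
  depth : ℕ
  nodeTime : ℕ

mutual

/-- `Call p x r c`: the procedure with body `p`, called on `x`, halts with the result `r`
(a solution, or `none`) at the cost `c`. -/
inductive Call (p : Prog) : Data → Option Data → Cost → Prop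
  | answer (x s : Data) (h : (p.eval [x]).1.action = .answer s) :
      Call p x (some s) ⟨(p.eval [x]).2 + 1, 0, (p.eval [x]).2 + 1⟩
  | branch (x : Data) (ys : List Data) (r : Option Data) (c : Cost)
      (h : (p.eval [x]).1.action = .branch ys) (hys : TryAll p ys r c) :
      Call p x r ⟨(p.eval [x]).2 + 1 + ys.length + c.time, c.depth,
        max ((p.eval [x]).2 + 1 + ys.length) c.nodeTime⟩

/-- `TryAll p ys r c`: calling the procedure with body `p` on the elements of `ys` in turn, until
a call returns a solution, halts with the result `r`. The recorded depth is `0` if there is no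
call, and one more than the largest depth of a call otherwise. -/
inductive TryAll (p : Prog) : List Data → Option Data → Cost → Prop
  | nil : TryAll p [] none ⟨0, 0, 0⟩
  | found (y : Data) (ys : List Data) (s : Data) (c : Cost) (h : Call p y (some s) c) :
      TryAll p (y :: ys) (some s) ⟨c.time, c.depth + 1, c.nodeTime⟩
  | next (y : Data) (ys : List Data) (r : Option Data) (c c' : Cost)
      (h : Call p y none c) (hys : TryAll p ys r c') :
      TryAll p (y :: ys) r
        ⟨c.time + c'.time, max (c.depth + 1) c'.depth, max c.nodeTime c'.nodeTime⟩

end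

/-- A result is correct if it is a proper list coloring, or if it is `none` and there is no proper
list coloring. -/
def IsCorrectResult {n k : ℕ} (H : Finset (Finset (Fin n))) (L : Fin n → Finset (Fin k)) :
    Option Data → Prop
  | some s => ∃ χ : Fin n → Fin k, IsProperListColoring H L χ ∧ s = encodeColoring χ
  | none => ¬ ∃ χ : Fin n → Fin k, IsProperListColoring H L χ

/-! ### Families of instances and polynomial bounds -/

-- Call an edge active in color `j` if all its vertices have `j` in their lists; only such an edge
-- can become monochromatic in `j`. Let `a` be a color with the most active edges, and give every
-- vertex with a choice the color `a` exactly if it lies in at least half of the `a`-active edges.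
-- If this trial coloring `χ` is proper, it is the answer. Otherwise some edge `E` is monochromatic,
-- in color `i` say.
--
-- Branching: in a proper coloring that uses `i` as often as possible, some `v ∈ E` has another
-- color, and recoloring it to `i` must make an edge `E'` monochromatic. So it suffices to try all
-- pairs `(v, E')`, deleting `i` from the list of `v` and all other colors from the lists on `E' \
-- {v}` (`Inst.exists_child_coloring`).
--
-- Progress: `E` stops being active in `i`. If `i = a`, then `v` is frequent (unless its list
-- becomes empty, which makes the subproblem a leaf), and at least half of the `a`-active edges are
-- lost. If `i ≠ a`, an edge that stays `a`-active contains `v`, which holds for at most half of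
-- them, or is disjoint from `E'`, which holds for at most `c`. So at most half plus `c` remain
-- (`Inst.two_mul_activeCount_child_le`), hence three quarters if there were at least `4 * c`. Below
-- this threshold every color has few active edges, and the one lost in color `i` counts. A
-- potential of order `k * (c + log m)` therefore decreases (`Inst.totalPotential_child_lt`); it
-- bounds the depth, and branching of degree at most `n * m` gives quasi-polynomial time
-- (`exists_call`).
--
-- It remains to see that the body is a polynomial-time program (`Comp.body`). `Comp` states value
-- and running time over an arbitrary family of instances, with one rule per program construct. A
-- loop adds its element and accumulator to the index of the family, so nested loops need no new
-- concept, and since the bounds hold for every accumulator, no sizes of data are tracked.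

/-- An instance of the coloring problem, with its edges listed. -/
structure Inst : Type where
  n : ℕ
  k : ℕ
  es : List (Finset (Fin n))
  L : Fin n → Finset (Fin k)

/-- The size in which running times of programs are measured. -/
def Inst.size (x : Inst) : ℕ := x.n + x.k + x.es.length + 1

/-- A function on a family of instances is polynomially bounded in the sizes. -/
def PolyIn {I : Type} (π : I → Inst) (f : I → ℕ) : Prop :=
  ∃ C a : ℕ, ∀ i, f i ≤ C * (π i).size ^ a

namespace PolyIn

variable {I : Type} {π : I → Inst} {f g : I → ℕ}

theorem mono (h : PolyIn π g) (hfg : ∀ i, f i ≤ g i) : PolyIn π f := by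
  obtain ⟨C, a, h⟩ := h
  exact ⟨C, a, fun i => (hfg i).trans (h i)⟩

theorem const (c : ℕ) : PolyIn π fun _ => c := ⟨c, 0, fun i => by simp⟩

theorem size : PolyIn π fun i => (π i).size := ⟨1, 1, fun i => by simp⟩

theorem add (hf : PolyIn π f) (hg : PolyIn π g) : PolyIn π fun i => f i + g i := by
  obtain ⟨C, a, hf⟩ := hf
  obtain ⟨C', a', hg⟩ := hg
  refine ⟨C + C', a + a', fun i => ?_⟩
  have h1 : 1 ≤ (π i).size := Nat.le_add_left _ _
  calc f i + g i ≤ C * (π i).size ^ a + C' * (π i).size ^ a' := add_le_add (hf i) (hg i)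
    _ ≤ C * (π i).size ^ (a + a') + C' * (π i).size ^ (a + a') := by
        gcongr <;> omega
    _ = _ := by ring

theorem mul (hf : PolyIn π f) (hg : PolyIn π g) : PolyIn π fun i => f i * g i := by
  obtain ⟨C, a, hf⟩ := hf
  obtain ⟨C', a', hg⟩ := hg
  refine ⟨C * C', a + a', fun i => ?_⟩
  calc f i * g i ≤ C * (π i).size ^ a * (C' * (π i).size ^ a') := Nat.mul_le_mul (hf i) (hg i)
    _ = _ := by ring

/-- Reindexing keeps the constants. It serves to restrict a family to the instances that pass a test
and to extend it by loop variables. -/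
theorem comp (hf : PolyIn π f) {J : Type} (r : J → I) :
    PolyIn (fun j => π (r j)) fun j => f (r j) := by
  obtain ⟨C, a, hf⟩ := hf
  exact ⟨C, a, fun j => hf (r j)⟩

theorem vertex (v : ∀ i, Fin (π i).n) : PolyIn π fun i => (v i : ℕ) :=
  size.mono fun i => by have := (v i).2; unfold Inst.size; omega

theorem color (j : ∀ i, Fin (π i).k) : PolyIn π fun i => (j i : ℕ) :=
  size.mono fun i => by have := (j i).2; unfold Inst.size; omega

end PolyIn

/-! ### Programs on families of environments -/

/-- On the environments `env i`, the program `P` has the values `val i`, in polynomial time. -/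
structure Comp {I : Type} (π : I → Inst) (P : Prog) (env : I → List Data) (val : I → Data) :
    Prop where
  value : ∀ i, (P.eval (env i)).1 = val i
  time : PolyIn π fun i => (P.eval (env i)).2

/-- The bit that tells whether a proposition holds. -/
noncomputable def bit (p : Prop) : Data := .ofBool (@decide p (Classical.propDecidable p))

theorem bit_of {p : Prop} (h : p) : bit p = .cons .nil .nil := by
  simp [bit, h, Data.ofBool]

theorem bit_of_not {p : Prop} (h : ¬ p) : bit p = .nil := by
  simp [bit, h, Data.ofBool]

theorem bit_ne_nil {p : Prop} : bit p ≠ .nil ↔ p := by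
  by_cases h : p <;> simp [bit, h, Data.ofBool]

theorem bit_eq (p : Prop) [Decidable p] : bit p = .ofBool (decide p) := by
  by_cases h : p <;> simp [bit, h]

/-- The index type for the body of a loop: the element and the accumulator vary. -/
structure Loop {I : Type} (β : I → Type) : Type where
  base : I
  elem : β base
  acc : Data

@[simp] theorem Data.spine_ofList (l : List Data) : (Data.ofList l).spine = l := by
  induction l with
  | nil => rfl
  | cons a l ih => simp [Data.ofList, Data.spine, ih]

namespace Comp

variable {I : Type} {π : I → Inst} {env : I → List Data} {P Q R : Prog} {u v w : I → Data}

theorem congr (h : Comp π P env u) (huv : ∀ i, u i = v i) : Comp π P env v :=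
  ⟨fun i => (h.value i).trans (huv i), h.time⟩

theorem comp (h : Comp π P env u) {J : Type} (r : J → I) :
    Comp (fun j => π (r j)) P (fun j => env (r j)) fun j => u (r j) :=
  ⟨fun j => h.value (r j), h.time.comp r⟩

theorem var (e : ℕ) (h : ∀ i, (env i).getD e .nil = v i) : Comp π (.var e) env v :=
  ⟨h, .const 1⟩

theorem nil : Comp π .nil env fun _ => .nil := ⟨fun _ => rfl, .const 1⟩

theorem cons (hP : Comp π P env u) (hQ : Comp π Q env v) :
    Comp π (.cons P Q) env fun i => .cons (u i) (v i) :=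
  ⟨fun i => by simp [Prog.eval, hP.value, hQ.value], (hP.time.add hQ.time).add (.const 1)⟩

theorem head (hP : Comp π P env u) : Comp π (.head P) env fun i => (u i).head :=
  ⟨fun i => by simp [Prog.eval, hP.value], hP.time.add (.const 1)⟩

theorem tail (hP : Comp π P env u) : Comp π (.tail P) env fun i => (u i).tail :=
  ⟨fun i => by simp [Prog.eval, hP.value], hP.time.add (.const 1)⟩

theorem bind (hP : Comp π P env u) (hQ : Comp π Q (fun i => u i :: env i) v) :
    Comp π (.bind P Q) env v := by
  have key : ∀ i, (P.eval (env i)).1 = u i := hP.value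
  constructor
  · intro i
    simp [Prog.eval, key, hQ.value]
  · refine ((hP.time.add hQ.time).add (.const 1)).mono fun i => ?_
    simp [Prog.eval, key]

/-- Each branch is analysed only on the subfamily that takes it, so what the test guarantees is
available there. The sum of the three time bounds covers both cases. -/
theorem ite_cases {p : I → Prop} (hR : Comp π R env u) (hp : ∀ i, u i ≠ .nil ↔ p i)
    (hP : Comp (fun i : {i // p i} => π i) P (fun i => env i) fun i => v i)
    (hQ : Comp (fun i : {i // ¬ p i} => π i) Q (fun i => env i) fun i => v i) :
    Comp π (.ite R P Q) env v := by
  have key : ∀ i, (R.eval (env i)).1 = u i := hR.value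
  have ev : ∀ i, (p i ∧ (Prog.ite R P Q).eval (env i) =
      ((P.eval (env i)).1, (R.eval (env i)).2 + (P.eval (env i)).2 + 1)) ∨
      (¬ p i ∧ (Prog.ite R P Q).eval (env i) =
      ((Q.eval (env i)).1, (R.eval (env i)).2 + (Q.eval (env i)).2 + 1)) := by
    intro i
    have hpi := hp i
    rw [← key i] at hpi
    rw [Prog.eval]
    cases h : (R.eval (env i)).1 with
    | nil => exact Or.inr ⟨fun hi => hpi.2 hi h, rfl⟩
    | cons a b => exact Or.inl ⟨hpi.1 (by simp [h]), rfl⟩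
  constructor
  · intro i
    rcases ev i with ⟨h, e⟩ | ⟨h, e⟩
    · rw [e]; exact hP.value ⟨i, h⟩
    · rw [e]; exact hQ.value ⟨i, h⟩
  · obtain ⟨C, a, h1⟩ := hR.time
    obtain ⟨C', a', h2⟩ := hP.time
    obtain ⟨C'', a'', h3⟩ := hQ.time
    refine PolyIn.mono (g := fun i => C * (π i).size ^ a + (C' * (π i).size ^ a' +
      C'' * (π i).size ^ a'') + 1) ?_ fun i => ?_
    · exact (PolyIn.add ⟨C, a, fun i => le_rfl⟩
        (PolyIn.add ⟨C', a', fun i => le_rfl⟩ ⟨C'', a'', fun i => le_rfl⟩)).add (.const 1)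
    · have := h1 i
      rcases ev i with ⟨h, e⟩ | ⟨h, e⟩
      · have := h2 ⟨i, h⟩
        simp only [e]; dsimp only at *; omega
      · have := h3 ⟨i, h⟩
        simp only [e]; dsimp only at *; omega

/-- Only a property of the value is tracked; this suits branches whose value depends on choices that
exist only on their own subfamily. -/
theorem ite_exists {p : I → Prop} {S : I → Data → Prop} (hR : Comp π R env u)
    (hp : ∀ i, u i ≠ .nil ↔ p i)
    (hP : ∃ v, Comp (fun i : {i // p i} => π i) P (fun i => env i) v ∧ ∀ i, S i.1 (v i))
    (hQ : ∃ v, Comp (fun i : {i // ¬ p i} => π i) Q (fun i => env i) v ∧ ∀ i, S i.1 (v i)) :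
    ∃ v, Comp π (.ite R P Q) env v ∧ ∀ i, S i (v i) := by
  classical
  obtain ⟨v1, h1, s1⟩ := hP
  obtain ⟨v2, h2, s2⟩ := hQ
  refine ⟨fun i => if h : p i then v1 ⟨i, h⟩ else v2 ⟨i, h⟩, ite_cases hR hp (h1.congr fun i => ?_)
    (h2.congr fun i => ?_), fun i => ?_⟩
  · simp [i.2]
  · simp [i.2]
  · by_cases h : p i
    · simpa [h] using s1 ⟨i, h⟩
    · simpa [h] using s2 ⟨i, h⟩

theorem ite {p : I → Prop} (hR : Comp π R env fun i => bit (p i)) (hP : Comp π P env u)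
    (hQ : Comp π Q env v) (h1 : ∀ i, p i → w i = u i) (h2 : ∀ i, ¬ p i → w i = v i) :
    Comp π (.ite R P Q) env w := by
  refine ite_cases (p := p) hR (fun i => bit_ne_nil) ((hP.comp Subtype.val).congr fun i => ?_)
    ((hQ.comp Subtype.val).congr fun i => ?_)
  · exact (h1 i i.2).symm
  · exact (h2 i i.2).symm

/-- The loop rule, for bodies that run in polynomial time whatever the accumulator. -/
theorem fold {β : I → Type} {enc : ∀ i, β i → Data} {xs : ∀ i, List (β i)}
    {g : ∀ i, β i → Data → Data}
    (hP : Comp π P env fun i => .ofList ((xs i).map (enc i)))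
    (hlen : PolyIn π fun i => (xs i).length)
    (hQ : Comp π Q env u)
    (hR : Comp (fun y : Loop β => π y.base) R
      (fun y => y.acc :: enc y.base y.elem :: env y.base) fun y => g y.base y.elem y.acc) :
    Comp π (.fold P Q R) env fun i => (xs i).foldl (fun s x => g i x s) (u i) := by
  have key : ∀ i, (P.eval (env i)).1.spine = (xs i).map (enc i) := fun i => by
    rw [hP.value i, Data.spine_ofList]
  obtain ⟨C, a, hC⟩ := hR.time
  -- The accumulator `s` and the steps `t` spent so far are generalized. The bound for one round is
  -- the same for all `s`, because the accumulator is part of the index in `hR`.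
  have main : ∀ i (l : List (β i)) (s : Data) (t : ℕ),
      ((l.map (enc i)).foldl (fun s x => ((R.eval (s.1 :: x :: env i)).1,
        s.2 + (R.eval (s.1 :: x :: env i)).2 + 1)) (s, t)).1 = l.foldl (fun s x => g i x s) s ∧
      ((l.map (enc i)).foldl (fun s x => ((R.eval (s.1 :: x :: env i)).1,
        s.2 + (R.eval (s.1 :: x :: env i)).2 + 1)) (s, t)).2 ≤
        t + l.length * (C * (π i).size ^ a + 1) := by
    intro i l
    induction l with
    | nil => intro s t; simp
    | cons x l ih =>
      intro s t
      have hv := hR.value ⟨i, x, s⟩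
      have ht := hC ⟨i, x, s⟩
      dsimp only at hv ht
      simp only [List.map_cons, List.foldl_cons, List.length_cons, hv]
      refine ⟨(ih _ _).1, (ih _ _).2.trans ?_⟩
      rw [Nat.add_mul (l.length) 1]
      omega
  constructor
  · intro i
    rw [Prog.eval, key, (main i _ _ _).1, hQ.value]
  · refine PolyIn.mono (((hP.time.add hQ.time).add (.const 1)).add
      (hlen.mul (PolyIn.add ⟨C, a, fun _ => le_rfl⟩ (.const 1)))) fun i => ?_
    rw [Prog.eval, key]
    exact (main i _ _ _).2

end Comp

/-! ### Derived program constructs -/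

namespace Prog

/-- The bit `1`. -/
def tt : Prog := .cons .nil .nil
/-- Negation; tests for `nil`. -/
def not (P : Prog) : Prog := .ite P .nil tt
/-- Conjunction. -/
def and (P Q : Prog) : Prog := .ite P Q .nil
/-- Implication. -/
def imp (P Q : Prog) : Prog := .ite P Q tt
/-- Whether the condition `b` holds for some element of the list `l`. -/
def any (l b : Prog) : Prog := .fold l .nil (.ite (.var 0) (.var 0) b)
/-- Whether the condition `b` holds for all elements of the list `l`. -/
def all (l b : Prog) : Prog := .not (.any l (.not b))
/-- The element of the list `l` at position `v`. -/
def nth (v l : Prog) : Prog := .head (.fold v l (.tail (.var 0)))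
/-- Comparison of unary numbers. -/
def le (x y : Prog) : Prog := .not (.fold y x (.tail (.var 0)))
/-- Equality of unary numbers. -/
def eq (x y : Prog) : Prog := .and (.le x y) (.le y x)
/-- The number of elements of the list `l` with the property `b`. -/
def count (l b : Prog) : Prog := .fold l .nil (.ite b (.cons .nil (.var 0)) (.var 0))
/-- The values of `b` on the elements of the list `l`, in reverse order. -/
def mapRev (l b : Prog) : Prog := .fold l .nil (.cons b (.var 0))
/-- The last element of the list `l` with the property `b`; if there is none, the value of `d`. -/
def find (l d b : Prog) : Prog := .fold l d (.ite b (.var 1) (.var 0))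
/-- The numbers below the length of a list, in decreasing order. -/
def iota (l : Prog) : Prog := .tail (.fold l tt (.cons (.cons .nil (.head (.var 0))) (.var 0)))

end Prog

theorem Data.ofNat_succ (j : ℕ) : Data.ofNat (j + 1) = .cons .nil (.ofNat j) := rfl

theorem Data.tail_ofNat (j : ℕ) : (Data.ofNat j).tail = .ofNat (j - 1) := by
  cases j <;> rfl

theorem Data.ofNat_eq_nil {j : ℕ} : Data.ofNat j = .nil ↔ j = 0 := by
  cases j with
  | zero => simp [Data.ofNat, Data.ofList]
  | succ j => simp [Data.ofNat_succ]

theorem Data.head_ofList (l : List Data) : (Data.ofList l).head = l.getD 0 .nil := by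
  cases l <;> rfl

theorem Data.tail_ofList (l : List Data) : (Data.ofList l).tail = .ofList l.tail := by
  cases l <;> rfl

open Classical in
/-- The code of the last element of a list with a given property; if there is none, `d`. -/
noncomputable def findLast {α : Type} (enc : α → Data) (b : α → Prop) (d : Data) (l : List α) :
    Data :=
  l.foldl (fun s x => if b x then enc x else s) d

theorem findLast_spec {α : Type} (enc : α → Data) (b : α → Prop) (d : Data) (l : List α) :
    (∃ x ∈ l, b x ∧ findLast enc b d l = enc x) ∨
      (∀ x ∈ l, ¬ b x) ∧ findLast enc b d l = d := by
  classical
  unfold findLast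
  induction l generalizing d with
  | nil => right; simp
  | cons x l ih =>
    simp only [List.foldl_cons]
    rcases ih (if b x then enc x else d) with ⟨y, hy, h⟩ | ⟨h1, h2⟩
    · exact Or.inl ⟨y, by simp [hy], h⟩
    · by_cases h : b x
      · exact Or.inl ⟨x, by simp, h, by simpa [h] using h2⟩
      · exact Or.inr ⟨by simpa [h] using h1, by simpa [h] using h2⟩

-- Values and running times of the derived constructs

namespace Comp

variable {I : Type} {π : I → Inst} {env : I → List Data} {P Q R : Prog} {u v w : I → Data}
  {p q : I → Prop}

theorem congr_bit (h : Comp π P env fun i => bit (p i)) (hpq : ∀ i, p i ↔ q i) :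
    Comp π P env fun i => bit (q i) :=
  h.congr fun i => by rw [propext (hpq i)]

theorem tt : Comp π .tt env fun _ => .cons .nil .nil := nil.cons nil

theorem isNil (hP : Comp π P env u) : Comp π (.not P) env fun i => bit (u i = .nil) := by
  refine ite_cases (p := fun i => u i ≠ .nil) hP (fun i => Iff.rfl)
    (nil.congr fun i => ?_) (tt.congr fun i => ?_)
  · rw [bit_of_not i.2]
  · rw [bit_of (not_not.1 i.2)]

theorem not (hP : Comp π P env fun i => bit (p i)) :
    Comp π (.not P) env fun i => bit (¬ p i) :=
  hP.isNil.congr_bit fun i => by by_cases h : p i <;> simp [bit_of, bit_of_not, h]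

theorem and (hP : Comp π P env fun i => bit (p i)) (hQ : Comp π Q env fun i => bit (q i)) :
    Comp π (.and P Q) env fun i => bit (p i ∧ q i) :=
  hP.ite hQ nil (fun i h => by simp [h]) fun i h => by simp [h, bit_of_not]

theorem imp (hP : Comp π P env fun i => bit (p i)) (hQ : Comp π Q env fun i => bit (q i)) :
    Comp π (.imp P Q) env fun i => bit (p i → q i) :=
  hP.ite hQ tt (fun i h => by simp [h]) fun i h => by simp [h, bit_of]

section loops

variable {β : I → Type} {enc : ∀ i, β i → Data} {xs : ∀ i, List (β i)} {b : ∀ i, β i → Prop}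

open Classical in
theorem any (hP : Comp π P env fun i => .ofList ((xs i).map (enc i)))
    (hlen : PolyIn π fun i => (xs i).length)
    (hR : Comp (fun y : Loop β => π y.base) R
      (fun y => y.acc :: enc y.base y.elem :: env y.base) fun y => bit (b y.base y.elem)) :
    Comp π (.any P R) env fun i => bit (∃ x ∈ xs i, b i x) := by
  have hb : Comp (fun y : Loop β => π y.base) (.ite (.var 0) (.var 0) R)
      (fun y => y.acc :: enc y.base y.elem :: env y.base)
      (fun y => if y.acc = .nil then bit (b y.base y.elem) else y.acc) :=
    ite_cases (p := fun y => y.acc ≠ .nil) (var 0 fun _ => rfl) (fun _ => Iff.rfl)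
      (var 0 fun y => by simp [y.2])
      ((hR.comp Subtype.val).congr fun y => by simp [not_not.1 y.2])
  refine (fold (g := fun i x s => if s = .nil then bit (b i x) else s) hP hlen nil hb).congr
    fun i => ?_
  -- A loop cannot stop early, so a success has to survive the remaining rounds.
  have h1 : ∀ l : List (β i), l.foldl (fun s x => if s = Data.nil then bit (b i x) else s)
      (.cons .nil .nil) = .cons .nil .nil := by
    intro l
    induction l with
    | nil => rfl
    | cons x l ih => simpa using ih
  induction xs i with
  | nil => simp [bit_of_not]
  | cons x l ih =>
    by_cases h : b i x
    · simp [h, bit_of, h1]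
    · simpa [h, bit_of_not] using ih

theorem all (hP : Comp π P env fun i => .ofList ((xs i).map (enc i)))
    (hlen : PolyIn π fun i => (xs i).length)
    (hR : Comp (fun y : Loop β => π y.base) R
      (fun y => y.acc :: enc y.base y.elem :: env y.base) fun y => bit (b y.base y.elem)) :
    Comp π (.all P R) env fun i => bit (∀ x ∈ xs i, b i x) :=
  (any (b := fun i x => ¬ b i x) hP hlen hR.not).not.congr_bit fun i => by simp

open Classical in
theorem count (hP : Comp π P env fun i => .ofList ((xs i).map (enc i)))
    (hlen : PolyIn π fun i => (xs i).length)
    (hR : Comp (fun y : Loop β => π y.base) R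
      (fun y => y.acc :: enc y.base y.elem :: env y.base) fun y => bit (b y.base y.elem)) :
    Comp π (.count P R) env fun i => .ofNat ((xs i).countP fun x => b i x) := by
  have hb : Comp (fun y : Loop β => π y.base) (.ite R (.cons .nil (.var 0)) (.var 0))
      (fun y => y.acc :: enc y.base y.elem :: env y.base)
      (fun y => if b y.base y.elem then .cons .nil y.acc else y.acc) :=
    hR.ite (nil.cons (var 0 fun _ => rfl)) (var 0 fun _ => rfl)
      (fun y h => by simp [h]) fun y h => by simp [h]
  refine (fold (g := fun i x s => if b i x then .cons .nil s else s) hP hlen nil hb).congr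
    fun i => ?_
  have h1 : ∀ (l : List (β i)) (j : ℕ), l.foldl (fun s x => if b i x then .cons .nil s else s)
      (Data.ofNat j) = .ofNat (j + l.countP fun x => b i x) := by
    intro l
    induction l with
    | nil => intro j; rfl
    | cons x l ih =>
      intro j
      by_cases h : b i x
      · simp only [List.foldl_cons, h, if_true, ← Data.ofNat_succ, ih]
        simp [h]; congr 1; omega
      · simp [h, ih]
  simpa [Data.ofNat, Data.ofList] using h1 (xs i) 0

theorem mapRev {f : ∀ i, β i → Data} (hP : Comp π P env fun i => .ofList ((xs i).map (enc i)))
    (hlen : PolyIn π fun i => (xs i).length)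
    (hR : Comp (fun y : Loop β => π y.base) R
      (fun y => y.acc :: enc y.base y.elem :: env y.base) fun y => f y.base y.elem) :
    Comp π (.mapRev P R) env fun i => .ofList ((xs i).reverse.map (f i)) := by
  refine (fold (g := fun i x s => .cons (f i x) s) hP hlen nil
    (hR.cons (var 0 fun _ => rfl))).congr fun i => ?_
  have h1 : ∀ l r : List Data, l.foldl (fun s x => .cons x s) (Data.ofList r) =
      .ofList (l.reverse ++ r) := by
    intro l
    induction l with
    | nil => intro r; rfl
    | cons x l ih => intro r; simpa [Data.ofList] using ih (x :: r)
  simpa [List.foldl_map, Data.ofList] using h1 ((xs i).map (f i)) []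

theorem find (hP : Comp π P env fun i => .ofList ((xs i).map (enc i)))
    (hlen : PolyIn π fun i => (xs i).length) (hQ : Comp π Q env u)
    (hR : Comp (fun y : Loop β => π y.base) R
      (fun y => y.acc :: enc y.base y.elem :: env y.base) fun y => bit (b y.base y.elem)) :
    Comp π (.find P Q R) env fun i => findLast (enc i) (b i) (u i) (xs i) := by
  classical
  have hb : Comp (fun y : Loop β => π y.base) (.ite R (.var 1) (.var 0))
      (fun y => y.acc :: enc y.base y.elem :: env y.base)
      (fun y => if b y.base y.elem then enc y.base y.elem else y.acc) :=
    hR.ite (var 1 fun _ => rfl) (var 0 fun _ => rfl)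
      (fun y h => by simp [h]) fun y h => by simp [h]
  refine (fold (g := fun i x s => if b i x then enc i x else s) hP hlen hQ hb).congr fun i => ?_
  unfold findLast
  congr!

end loops

theorem foldTail {f : I → ℕ} (hP : Comp π P env fun i => .ofNat (f i)) (hf : PolyIn π f)
    (hQ : Comp π Q env u) :
    Comp π (.fold P Q (.tail (.var 0))) env fun i => Data.tail^[f i] (u i) := by
  refine (fold (β := fun _ => Data) (enc := fun _ => id) (xs := fun i => List.replicate (f i) .nil)
    (g := fun _ _ s => s.tail) (hP.congr fun i => ?_) (hf.mono fun i => ?_) hQ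
    (var 0 fun _ => rfl).tail).congr fun i => ?_
  · simp [Data.ofNat]
  · simp
  · generalize u i = s
    generalize f i = j
    induction j generalizing s with
    | zero => rfl
    | succ j ih => simp [List.replicate_succ, ih]

theorem nth {f : I → ℕ} {l : I → List Data} (hP : Comp π P env fun i => .ofNat (f i))
    (hf : PolyIn π f) (hQ : Comp π Q env fun i => .ofList (l i)) :
    Comp π (.nth P Q) env fun i => (l i).getD (f i) .nil := by
  refine (foldTail hP hf hQ).head.congr fun i => ?_
  generalize l i = r
  generalize f i = j
  induction j generalizing r with
  | zero => simp [Data.head_ofList]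
  | succ j ih =>
    rw [Function.iterate_succ_apply, Data.tail_ofList, ih]
    cases r <;> simp

/-- Truncated subtraction in unary: `g i` times `tail` leaves `nil` exactly if nothing of `f i`
remains. -/
theorem le {f g : I → ℕ} (hP : Comp π P env fun i => .ofNat (f i))
    (hQ : Comp π Q env fun i => .ofNat (g i)) (hg : PolyIn π g) :
    Comp π (.le P Q) env fun i => bit (f i ≤ g i) := by
  refine (foldTail hQ hg hP).isNil.congr_bit fun i => ?_
  generalize f i = a
  generalize g i = j
  induction j generalizing a with
  | zero => simp [Data.ofNat_eq_nil]
  | succ j ih => rw [Function.iterate_succ_apply, Data.tail_ofNat, ih]; omega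

theorem eq {f g : I → ℕ} (hP : Comp π P env fun i => .ofNat (f i)) (hf : PolyIn π f)
    (hQ : Comp π Q env fun i => .ofNat (g i)) (hg : PolyIn π g) :
    Comp π (.eq P Q) env fun i => bit (f i = g i) :=
  ((hP.le hQ hg).and (hQ.le hP hf)).congr_bit fun i => by omega

/-- The loop starts with the list of `0` alone and puts the successor of the head in front, once per
element; this also produces the length itself, which the final `tail` removes. -/
theorem iota {l : I → List Data} (hP : Comp π P env fun i => .ofList (l i))
    (hlen : PolyIn π fun i => (l i).length) :
    Comp π (.iota P) env fun i => .ofList ((List.range (l i).length).reverse.map .ofNat) := by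
  refine (fold (β := fun _ => Data) (enc := fun _ => id) (xs := l)
    (g := fun _ _ s => .cons (.cons .nil s.head) s) (by simpa using hP) hlen tt
    ((nil.cons (var 0 fun _ => rfl).head).cons (var 0 fun _ => rfl))).tail.congr fun i => ?_
  have h1 : ∀ r : List Data, r.foldl (fun s _ => .cons (.cons .nil s.head) s)
      (Data.cons .nil .nil) = .ofList ((List.range (r.length + 1)).reverse.map Data.ofNat) := by
    intro r
    induction r using List.reverseRecOn with
    | nil => rfl
    | append_singleton r x ih =>
      rw [List.foldl_append, ih, List.foldl_cons, List.foldl_nil, List.length_append,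
        List.length_singleton, List.range_succ (n := r.length + 1), List.range_succ]
      simp [Data.ofList, Data.head, Data.ofNat_succ]
  rw [h1, List.range_succ]
  simp [Data.ofList, Data.tail]

/-- Sets are characteristic vectors, so the entry at position `x` is already the membership bit. -/
theorem mem {n : I → ℕ} {x : ∀ i, Fin (n i)} {s : ∀ i, Finset (Fin (n i))}
    (hP : Comp π P env fun i => .ofNat (x i)) (hf : PolyIn π fun i => (x i : ℕ))
    (hQ : Comp π Q env fun i => .ofFinset (s i)) :
    Comp π (.nth P Q) env fun i => bit (x i ∈ s i) :=
  (hP.nth hf hQ).congr fun i => by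
    simp [bit_eq]

end Comp

/-! ### The body of the procedure -/

/-- All vertices of the edge have the color `j` in their lists. -/
def Active {n k : ℕ} (L : Fin n → Finset (Fin k)) (j : Fin k) (E : Finset (Fin n)) : Prop :=
  ∀ v ∈ E, j ∈ L v

open Classical in
/-- At least half of the edges that could still be monochromatic in color `a` contain `v`. -/
def Inst.Frequent (x : Inst) (a : Fin x.k) (v : Fin x.n) : Prop :=
  (x.es.countP fun E => Active x.L a E ∧ v ∉ E) ≤ x.es.countP fun E => Active x.L a E ∧ v ∈ E

/-- Every edge avoids the color of `v` at `v`, and `E'` gets this color at its other vertices. -/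
def Inst.child (x : Inst) (χ : Fin x.n → Fin x.k) (v : Fin x.n) (E' : Finset (Fin x.n)) :
    Fin x.n → Finset (Fin x.k) :=
  fun u => (x.L u).filter fun i => if u = v then i ≠ χ v else u ∈ E' → i = χ v

/-- The subproblems for the monochromatic edge `E`. -/
def Inst.children (x : Inst) (χ : Fin x.n → Fin x.k) (E : Finset (Fin x.n)) :
    List (Fin x.n → Finset (Fin x.k)) :=
  ((List.finRange x.n).reverse.filter (· ∈ E)).flatMap fun v => x.es.map (x.child χ v)

/-- All vertices of `E` have the same color. -/
def IsMono {n k : ℕ} (χ : Fin n → Fin k) (E : Finset (Fin n)) : Prop :=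
  ∀ v ∈ E, ∀ u ∈ E, χ u = χ v

/-- A coloring from the lists in which a vertex with a choice gets the color `a` exactly if it is
frequent. -/
structure Inst.IsTrial (x : Inst) (a : Fin x.k) (χ : Fin x.n → Fin x.k) : Prop where
  mem : ∀ v, χ v ∈ x.L v
  frequent : ∀ v, χ v = a → ∀ j ∈ x.L v, j ≠ a → x.Frequent a v
  not_frequent : ∀ v, χ v ≠ a → a ∈ x.L v → ¬ x.Frequent a v

open Classical in
/-- `a` is a color with the largest number of edges that could still be monochromatic in it. -/
def Inst.IsLargest (x : Inst) (a : Fin x.k) : Prop :=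
  ∀ j, (x.es.countP fun E => Active x.L j E) ≤ x.es.countP fun E => Active x.L a E

/-- The argument of the procedure for the lists `L`. -/
def Inst.arg (x : Inst) (L : Fin x.n → Finset (Fin x.k)) : Data :=
  .cons (encodeInput x.es L) .nil

/-- What the body of the procedure computes. -/
inductive Inst.Outcome (x : Inst) : Data → Prop
  | degenerate (h0 : x.n = 0) (hes : x.es ≠ []) : x.Outcome .nil
  | emptyList (v : Fin x.n) (hv : x.L v = ∅) : x.Outcome .nil
  | answer (χ : Fin x.n → Fin x.k) (hmem : ∀ v, χ v ∈ x.L v) (h : ∀ E ∈ x.es, ¬ IsMono χ E) :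
      x.Outcome (.cons .nil (encodeColoring χ))
  | branch (a : Fin x.k) (χ : Fin x.n → Fin x.k) (E : Finset (Fin x.n))
      (ha : x.IsLargest a) (hχ : x.IsTrial a χ) (hE : E ∈ x.es) (hmono : IsMono χ E)
      (hL : ∀ v, x.L v ≠ ∅) :
      x.Outcome (.cons (.cons .nil .nil) (.ofList ((x.children χ E).reverse.map x.arg)))

namespace Inst

/-- The codes of the vertices. -/
def vsData (x : Inst) : Data := .ofList ((List.range x.n).reverse.map .ofNat)
/-- The codes of the colors. -/
def csData (x : Inst) : Data := .ofList ((List.range x.k).reverse.map .ofNat)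
/-- The code of the lists. -/
def LsData (x : Inst) : Data := .ofList (List.ofFn fun v => Data.ofFinset (x.L v))
/-- The code of the edges. -/
def esData (x : Inst) : Data := .ofList (x.es.map Data.ofFinset)

theorem vsData_eq (x : Inst) :
    x.vsData = .ofList ((List.finRange x.n).reverse.map fun v : Fin x.n => Data.ofNat v) := by
  rw [vsData, ← List.map_coe_finRange_eq_range, ← List.map_reverse, List.map_map]
  rfl

theorem csData_eq (x : Inst) :
    x.csData = .ofList ((List.finRange x.k).reverse.map fun v : Fin x.k => Data.ofNat v) := by
  rw [csData, ← List.map_coe_finRange_eq_range, ← List.map_reverse, List.map_map]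
  rfl

end Inst

namespace Prog

/-- Whether the edge `e` is active in color `j`. -/
def active (vs Ls e j : ℕ) : Prog :=
  .all (.var vs) (.imp (.nth (.var 1) (.var (e + 2)))
    (.nth (.var (j + 2)) (.nth (.var 1) (.var (Ls + 2)))))

/-- Whether some list is empty; colors, vertices, lists, edges in the environment. -/
def hasEmpty : Prog :=
  .any (.var 1) (.not (.any (.var 2) (.nth (.var 1) (.nth (.var 3) (.var 6)))))

/-- A color with the largest number of active edges. -/
def largest : Prog :=
  .find (.var 0) .nil (.all (.var 2)
    (.le (.count (.var 7) (active 7 8 1 3)) (.count (.var 7) (active 7 8 1 5))))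

/-- Whether a vertex is frequent. -/
def frequent : Prog :=
  .le (.count (.var 8) (.and (active 8 9 1 6) (.not (.nth (.var 5) (.var 1)))))
    (.count (.var 8) (.and (active 8 9 1 6) (.nth (.var 5) (.var 1))))

/-- The color of a vertex in the trial coloring. -/
def trialColor : Prog :=
  .find (.var 3) (.find (.var 3) .nil (.nth (.var 1) (.nth (.var 3) (.var 7))))
    (.and (.nth (.var 1) (.nth (.var 3) (.var 7)))
      (.and (.imp (.eq (.var 1) (.var 4)) frequent)
        (.imp frequent (.eq (.var 1) (.var 4)))))

/-- Whether an edge is monochromatic in the trial coloring. -/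
def mono : Prog :=
  .all (.var 5) (.imp (.nth (.var 1) (.var 3))
    (.all (.var 7) (.imp (.nth (.var 1) (.var 5))
      (.eq (.nth (.var 1) (.var 6)) (.nth (.var 3) (.var 6))))))

/-- Whether a color remains in the list of a vertex. -/
def childEntry : Prog :=
  .and (.nth (.var 1) (.nth (.var 3) (.var 13)))
    (.ite (.eq (.var 3) (.var 7)) (.not (.eq (.var 1) (.nth (.var 7) (.var 9))))
      (.imp (.nth (.var 3) (.var 5)) (.eq (.var 1) (.nth (.var 7) (.var 9)))))

/-- The argument for a subproblem. -/
def childArg : Prog :=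
  .cons (.cons (.var 10) (.mapRev (.var 8) (.mapRev (.var 9) childEntry))) .nil

/-- All subproblems. -/
def branches : Prog :=
  .fold (.var 4) .nil (.ite (.nth (.var 1) (.var 2)) (.fold (.var 8) (.var 0)
    (.cons childArg (.var 0))) (.var 0))

/-- The body, once the lists are known to be nonempty. -/
def search : Prog :=
  .bind largest <| .bind (.mapRev (.var 2) trialColor) <|
    .ite (.any (.var 5) mono)
      (.bind (.find (.var 5) (.mapRev (.var 3) .nil) mono) (.cons tt branches))
      (.cons .nil (.var 0))

/-- The body of the procedure. -/
def body : Prog :=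
  .bind (.head (.head (.var 0))) <| .bind (.tail (.head (.var 1))) <|
    .ite (.var 0)
      (.bind (.iota (.var 0)) <| .bind (.iota (.head (.var 1))) <| .ite hasEmpty .nil search)
      (.ite (.var 1) .nil (.cons .nil .nil))

end Prog

-- Verification of the body

namespace Comp

variable {I : Type} {π : I → Inst} {env : I → List Data} {P Q R : Prog}

section loops

variable {u : I → Data}

theorem poly_n : PolyIn π fun i => ((List.finRange (π i).n).reverse).length :=
  PolyIn.size.mono fun i => by
    simp only [List.length_reverse, List.length_finRange, Inst.size]; omega

theorem poly_k : PolyIn π fun i => ((List.finRange (π i).k).reverse).length :=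
  PolyIn.size.mono fun i => by
    simp only [List.length_reverse, List.length_finRange, Inst.size]; omega

theorem poly_m : PolyIn π fun i => (π i).es.length :=
  PolyIn.size.mono fun i => by simp only [Inst.size]; omega

theorem vertexVar (e : ℕ) (h : ∀ i, (env i).getD e .nil = (π i).vsData) :
    Comp π (.var e) env fun i =>
      .ofList ((List.finRange (π i).n).reverse.map fun v : Fin (π i).n => Data.ofNat v) :=
  var e fun i => (h i).trans (π i).vsData_eq

theorem colorVar (e : ℕ) (h : ∀ i, (env i).getD e .nil = (π i).csData) :
    Comp π (.var e) env fun i =>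
      .ofList ((List.finRange (π i).k).reverse.map fun v : Fin (π i).k => Data.ofNat v) :=
  var e fun i => (h i).trans (π i).csData_eq

theorem edgeVar (e : ℕ) (h : ∀ i, (env i).getD e .nil = (π i).esData) :
    Comp π (.var e) env fun i => .ofList ((π i).es.map Data.ofFinset) :=
  var e h


theorem anyV {e : ℕ} {b : ∀ i, Fin (π i).n → Prop}
    (h : ∀ i, (env i).getD e .nil = (π i).vsData)
    (hR : Comp (fun y : Loop fun i => Fin (π i).n => π y.base) R
      (fun y => y.acc :: .ofNat y.elem :: env y.base) fun y => bit (b y.base y.elem)) :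
    Comp π (.any (.var e) R) env fun i => bit (∃ x, b i x) :=
  (any (vertexVar e h) poly_n hR).congr_bit fun i => by simp

theorem allV {e : ℕ} {b : ∀ i, Fin (π i).n → Prop}
    (h : ∀ i, (env i).getD e .nil = (π i).vsData)
    (hR : Comp (fun y : Loop fun i => Fin (π i).n => π y.base) R
      (fun y => y.acc :: .ofNat y.elem :: env y.base) fun y => bit (b y.base y.elem)) :
    Comp π (.all (.var e) R) env fun i => bit (∀ x, b i x) :=
  (all (vertexVar e h) poly_n hR).congr_bit fun i => by simp

theorem anyC {e : ℕ} {b : ∀ i, Fin (π i).k → Prop}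
    (h : ∀ i, (env i).getD e .nil = (π i).csData)
    (hR : Comp (fun y : Loop fun i => Fin (π i).k => π y.base) R
      (fun y => y.acc :: .ofNat y.elem :: env y.base) fun y => bit (b y.base y.elem)) :
    Comp π (.any (.var e) R) env fun i => bit (∃ x, b i x) :=
  (any (colorVar e h) poly_k hR).congr_bit fun i => by simp

theorem allC {e : ℕ} {b : ∀ i, Fin (π i).k → Prop}
    (h : ∀ i, (env i).getD e .nil = (π i).csData)
    (hR : Comp (fun y : Loop fun i => Fin (π i).k => π y.base) R
      (fun y => y.acc :: .ofNat y.elem :: env y.base) fun y => bit (b y.base y.elem)) :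
    Comp π (.all (.var e) R) env fun i => bit (∀ x, b i x) :=
  (all (colorVar e h) poly_k hR).congr_bit fun i => by simp

theorem anyE {e : ℕ} {b : ∀ i, Finset (Fin (π i).n) → Prop}
    (h : ∀ i, (env i).getD e .nil = (π i).esData)
    (hR : Comp (fun y : Loop fun i => Finset (Fin (π i).n) => π y.base) R
      (fun y => y.acc :: .ofFinset y.elem :: env y.base) fun y => bit (b y.base y.elem)) :
    Comp π (.any (.var e) R) env fun i => bit (∃ x ∈ (π i).es, b i x) :=
  any (edgeVar e h) poly_m hR

open Classical in
theorem countE {e : ℕ} {b : ∀ i, Finset (Fin (π i).n) → Prop}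
    (h : ∀ i, (env i).getD e .nil = (π i).esData)
    (hR : Comp (fun y : Loop fun i => Finset (Fin (π i).n) => π y.base) R
      (fun y => y.acc :: .ofFinset y.elem :: env y.base) fun y => bit (b y.base y.elem)) :
    Comp π (.count (.var e) R) env fun i => .ofNat ((π i).es.countP fun E => b i E) :=
  count (edgeVar e h) poly_m hR

theorem mapV {e : ℕ} {f : ∀ i, Fin (π i).n → Data}
    (h : ∀ i, (env i).getD e .nil = (π i).vsData)
    (hR : Comp (fun y : Loop fun i => Fin (π i).n => π y.base) R
      (fun y => y.acc :: .ofNat y.elem :: env y.base) fun y => f y.base y.elem) :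
    Comp π (.mapRev (.var e) R) env fun i => .ofList (List.ofFn (f i)) :=
  (mapRev (f := f) (vertexVar e h) poly_n hR).congr fun i => by
    rw [List.reverse_reverse, List.ofFn_eq_map]

theorem mapC {e : ℕ} {f : ∀ i, Fin (π i).k → Data}
    (h : ∀ i, (env i).getD e .nil = (π i).csData)
    (hR : Comp (fun y : Loop fun i => Fin (π i).k => π y.base) R
      (fun y => y.acc :: .ofNat y.elem :: env y.base) fun y => f y.base y.elem) :
    Comp π (.mapRev (.var e) R) env fun i => .ofList (List.ofFn (f i)) :=
  (mapRev (f := f) (colorVar e h) poly_k hR).congr fun i => by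
    rw [List.reverse_reverse, List.ofFn_eq_map]

theorem findC {e : ℕ} {b : ∀ i, Fin (π i).k → Prop}
    (h : ∀ i, (env i).getD e .nil = (π i).csData) (hQ : Comp π Q env u)
    (hR : Comp (fun y : Loop fun i => Fin (π i).k => π y.base) R
      (fun y => y.acc :: .ofNat y.elem :: env y.base) fun y => bit (b y.base y.elem)) :
    Comp π (.find (.var e) Q R) env fun i =>
      findLast (fun v : Fin (π i).k => .ofNat v) (b i) (u i) (List.finRange (π i).k).reverse :=
  find (colorVar e h) poly_k hQ hR

theorem findE {e : ℕ} {b : ∀ i, Finset (Fin (π i).n) → Prop}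
    (h : ∀ i, (env i).getD e .nil = (π i).esData) (hQ : Comp π Q env u)
    (hR : Comp (fun y : Loop fun i => Finset (Fin (π i).n) => π y.base) R
      (fun y => y.acc :: .ofFinset y.elem :: env y.base) fun y => bit (b y.base y.elem)) :
    Comp π (.find (.var e) Q R) env fun i =>
      findLast Data.ofFinset (b i) (u i) (π i).es :=
  find (edgeVar e h) poly_m hQ hR

end loops

theorem memList {c : ∀ i, Fin (π i).k} {v : ∀ i, Fin (π i).n}
    (hc : Comp π P env fun i => .ofNat (c i)) (hv : Comp π Q env fun i => .ofNat (v i))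
    (hL : Comp π R env fun i => (π i).LsData) :
    Comp π (.nth P (.nth Q R)) env fun i => bit (c i ∈ (π i).L (v i)) :=
  mem hc (PolyIn.color c) ((hv.nth (PolyIn.vertex v) hL).congr fun i => by simp)

theorem eqC {c d : ∀ i, Fin (π i).k} (hP : Comp π P env fun i => .ofNat (c i))
    (hQ : Comp π Q env fun i => .ofNat (d i)) : Comp π (.eq P Q) env fun i => bit (c i = d i) :=
  (eq hP (PolyIn.color c) hQ (PolyIn.color d)).congr_bit fun _ => Fin.ext_iff.symm

theorem eqV {c d : ∀ i, Fin (π i).n} (hP : Comp π P env fun i => .ofNat (c i))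
    (hQ : Comp π Q env fun i => .ofNat (d i)) : Comp π (.eq P Q) env fun i => bit (c i = d i) :=
  (eq hP (PolyIn.vertex c) hQ (PolyIn.vertex d)).congr_bit fun _ => Fin.ext_iff.symm

theorem memE {E : ∀ i, Finset (Fin (π i).n)} {v : ∀ i, Fin (π i).n}
    (hv : Comp π P env fun i => .ofNat (v i)) (hE : Comp π Q env fun i => .ofFinset (E i)) :
    Comp π (.nth P Q) env fun i => bit (v i ∈ E i) :=
  mem hv (PolyIn.vertex v) hE

theorem colorAt {χ : ∀ i, Fin (π i).n → Fin (π i).k} {v : ∀ i, Fin (π i).n}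
    (hv : Comp π P env fun i => .ofNat (v i)) (hχ : Comp π Q env fun i => encodeColoring (χ i)) :
    Comp π (.nth P Q) env fun i => .ofNat (χ i (v i)) :=
  (hv.nth (PolyIn.vertex v) hχ).congr fun i => by simp

/-- A loop puts its accumulator and its element in front of the environment, so outer variables move
by two places; the `rfl` proofs at the uses check the de Bruijn positions. -/
theorem active {vs Ls e j : ℕ} {E : ∀ i, Finset (Fin (π i).n)} {c : ∀ i, Fin (π i).k}
    (hvs : ∀ i, (env i).getD vs .nil = (π i).vsData)
    (hLs : ∀ i, (env i).getD Ls .nil = (π i).LsData)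
    (hE : ∀ i, (env i).getD e .nil = .ofFinset (E i))
    (hj : ∀ i, (env i).getD j .nil = .ofNat (c i)) :
    Comp π (.active vs Ls e j) env fun i => bit (Active (π i).L (c i) (E i)) := by
  refine allV (b := fun i v => v ∈ E i → c i ∈ (π i).L v) hvs (imp ?_ ?_)
  · exact memE (var 1 fun _ => rfl) (var _ fun y => hE y.base)
  · exact memList (c := fun y : Loop fun i => Fin (π i).n => c y.base) (v := Loop.elem)
      (var _ fun y => hj y.base) (var 1 fun _ => rfl) (var _ fun y => hLs y.base)

/-- The environment of the body once the data have been read. -/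
def baseEnv (x : Inst) : List Data := [x.csData, x.vsData, x.LsData, x.esData, x.arg x.L]

theorem hasEmpty (henv : ∀ i, env i = baseEnv (π i)) :
    Comp π .hasEmpty env fun i => bit (∃ v, (π i).L v = ∅) := by
  obtain rfl : env = fun i => baseEnv (π i) := funext henv
  refine (anyV (b := fun i v => ¬ ∃ c, c ∈ (π i).L v) (fun _ => rfl) (not
    (anyC (b := fun (y : Loop fun i => Fin (π i).n) c => c ∈ (π y.base).L y.elem)
      (fun _ => rfl) ?_))).congr_bit fun i => ?_
  · exact memList (var 1 fun _ => rfl) (var 3 fun _ => rfl) (var 6 fun _ => rfl)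
  · simp [Finset.eq_empty_iff_forall_notMem]

theorem largest (henv : ∀ i, env i = baseEnv (π i)) :
    Comp π .largest env fun i => findLast (fun v : Fin (π i).k => .ofNat v) (π i).IsLargest .nil
      (List.finRange (π i).k).reverse := by
  classical
  obtain rfl : env = fun i => baseEnv (π i) := funext henv
  refine findC (b := fun i a => (π i).IsLargest a) (fun _ => rfl) nil
    (allC (b := fun (y : Loop fun i => Fin (π i).k) j =>
      ((π y.base).es.countP fun E => Active (π y.base).L j E) ≤
        (π y.base).es.countP fun E => Active (π y.base).L y.elem E) (fun _ => rfl) (le ?_ ?_ ?_))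
  · exact countE (b := fun (z : Loop fun y : Loop fun i => Fin (π i).k => Fin (π y.base).k) E =>
        Active (π z.base.base).L z.elem E) (fun _ => rfl)
      (active (fun _ => rfl) (fun _ => rfl)
        (fun _ => rfl) fun _ => rfl)
  · exact countE (b := fun (z : Loop fun y : Loop fun i => Fin (π i).k => Fin (π y.base).k) E =>
        Active (π z.base.base).L z.base.elem E) (fun _ => rfl)
      (active (fun _ => rfl) (fun _ => rfl)
        (fun _ => rfl) fun _ => rfl)
  · exact poly_m.mono fun z => List.countP_le_length

/-- The environment for the trial coloring. -/
def trialEnv (x : Inst) (a : Fin x.k) : List Data := .ofNat a :: baseEnv x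

theorem frequent {a : ∀ i, Fin (π i).k} {v : ∀ i, Fin (π i).n} {s t t' : I → Data}
    (henv : ∀ i, env i = s i :: t i :: t' i :: .ofNat (v i) :: trialEnv (π i) (a i)) :
    Comp π .frequent env fun i => bit ((π i).Frequent (a i) (v i)) := by
  classical
  obtain rfl : env = fun i => s i :: t i :: t' i :: .ofNat (v i) :: trialEnv (π i) (a i) :=
    funext henv
  have hmem : Comp (fun y : Loop fun i => Finset (Fin (π i).n) => π y.base)
      (.nth (.var 5) (.var 1)) (fun y => y.acc :: .ofFinset y.elem :: s y.base :: t y.base ::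
        t' y.base :: .ofNat (v y.base) :: trialEnv (π y.base) (a y.base))
      fun y => bit (v y.base ∈ y.elem) :=
    memE (π := fun y : Loop fun i => Finset (Fin (π i).n) => π y.base) (v := fun y => v y.base)
      (E := Loop.elem) (var 5 fun _ => rfl) (var _ fun y => rfl)
  have hact : Comp (fun y : Loop fun i => Finset (Fin (π i).n) => π y.base)
      (.active 8 9 1 6) (fun y => y.acc :: .ofFinset y.elem :: s y.base :: t y.base ::
        t' y.base :: .ofNat (v y.base) :: trialEnv (π y.base) (a y.base))
      fun y => bit (Active (π y.base).L (a y.base) y.elem) :=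
    active (fun _ => rfl) (fun _ => rfl) (fun _ => rfl) fun _ => rfl
  refine (le (countE (b := fun i E => Active (π i).L (a i) E ∧ v i ∉ E) (fun _ => rfl)
    (hact.and hmem.not)) (countE (b := fun i E => Active (π i).L (a i) E ∧ v i ∈ E) (fun _ => rfl)
    (hact.and hmem)) (poly_m.mono fun z => List.countP_le_length)).congr_bit fun i => ?_
  unfold Inst.Frequent
  congr!

/-- The code of the trial color of a vertex. -/
noncomputable def trialValue (x : Inst) (a : Fin x.k) (v : Fin x.n) : Data :=
  findLast (fun j : Fin x.k => .ofNat j) (fun j => j ∈ x.L v ∧ (j = a → x.Frequent a v) ∧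
    (x.Frequent a v → j = a)) (findLast (fun j : Fin x.k => .ofNat j) (fun j => j ∈ x.L v) .nil
      (List.finRange x.k).reverse) (List.finRange x.k).reverse

theorem trialColor {a : ∀ i, Fin (π i).k} (henv : ∀ i, env i = trialEnv (π i) (a i)) :
    Comp π (.mapRev (.var 2) .trialColor) env fun i =>
      .ofList (List.ofFn fun v => trialValue (π i) (a i) v) := by
  obtain rfl : env = fun i => trialEnv (π i) (a i) := funext henv
  have hmem : Comp (fun z : Loop fun y : Loop fun i => Fin (π i).n => Fin (π y.base).k =>
      π z.base.base) (.nth (.var 1) (.nth (.var 3) (.var 7))) (fun z => z.acc :: .ofNat z.elem ::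
        z.base.acc :: .ofNat z.base.elem :: trialEnv (π z.base.base) (a z.base.base))
      fun z => bit (z.elem ∈ (π z.base.base).L z.base.elem) :=
    memList (var 1 fun _ => rfl) (var 3 fun _ => rfl) (var 7 fun _ => rfl)
  have heq : Comp (fun z : Loop fun y : Loop fun i => Fin (π i).n => Fin (π y.base).k =>
      π z.base.base) (.eq (.var 1) (.var 4)) (fun z => z.acc :: .ofNat z.elem ::
        z.base.acc :: .ofNat z.base.elem :: trialEnv (π z.base.base) (a z.base.base))
      fun z => bit (z.elem = a z.base.base) :=
    eqC (π := fun z : Loop fun y : Loop fun i => Fin (π i).n => Fin (π y.base).k => π z.base.base)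
      (var 1 fun _ => rfl) (var 4 fun _ => rfl)
  have hfr : Comp (fun z : Loop fun y : Loop fun i => Fin (π i).n => Fin (π y.base).k =>
      π z.base.base) .frequent (fun z => z.acc :: .ofNat z.elem ::
        z.base.acc :: .ofNat z.base.elem :: trialEnv (π z.base.base) (a z.base.base))
      fun z => bit ((π z.base.base).Frequent (a z.base.base) z.base.elem) :=
    frequent fun _ => rfl
  exact mapV (f := fun i v => trialValue (π i) (a i) v) (fun _ => rfl)
    (findC (π := fun y : Loop fun i => Fin (π i).n => π y.base)
      (b := fun y j => j ∈ (π y.base).L y.elem ∧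
        (j = a y.base → (π y.base).Frequent (a y.base) y.elem) ∧
        ((π y.base).Frequent (a y.base) y.elem → j = a y.base)) (fun _ => rfl)
      (findC (π := fun y : Loop fun i => Fin (π i).n => π y.base)
        (b := fun y j => j ∈ (π y.base).L y.elem) (fun _ => rfl) nil hmem)
      (hmem.and ((heq.imp hfr).and (hfr.imp heq))))

theorem exists_trial (x : Inst) (a : Fin x.k) (hL : ∀ v, x.L v ≠ ∅) :
    ∃ χ, x.IsTrial a χ ∧ ∀ v, trialValue x a v = .ofNat (χ v) := by
  have h : ∀ v, ∃ j : Fin x.k, trialValue x a v = .ofNat j ∧ j ∈ x.L v ∧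
      (j = a → ∀ j ∈ x.L v, j ≠ a → x.Frequent a v) ∧
      (j ≠ a → a ∈ x.L v → ¬ x.Frequent a v) := by
    intro v
    obtain ⟨j0, hj0⟩ := Finset.nonempty_iff_ne_empty.2 (hL v)
    rcases findLast_spec (fun j : Fin x.k => .ofNat j) (fun j => j ∈ x.L v ∧
      (j = a → x.Frequent a v) ∧ (x.Frequent a v → j = a))
      (findLast (fun j : Fin x.k => .ofNat j) (fun j => j ∈ x.L v) .nil
      (List.finRange x.k).reverse) (List.finRange x.k).reverse with ⟨j, -, hj, h⟩ | ⟨h1, h2⟩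
    · exact ⟨j, h, by grind⟩
    -- No color of the list is on the right side of the test: `a` is missing if `v` is frequent, and
    -- the list is `{a}` otherwise. So `v` has no relevant choice, and any color of its list will
    -- do.
    · rcases findLast_spec (fun j : Fin x.k => .ofNat j) (fun j => j ∈ x.L v) .nil
        (List.finRange x.k).reverse with ⟨j, -, hj, h⟩ | ⟨h3, -⟩
      · refine ⟨j, h2.trans h, hj, ?_⟩
        have h1' : ∀ j, _ := fun j => h1 j (by simp)
        grind
      · exact absurd hj0 (h3 j0 (by simp))
  choose χ h1 h2 h3 h4 using h
  exact ⟨χ, ⟨h2, h3, h4⟩, h1⟩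

end Comp

namespace Comp

variable {I : Type} {π : I → Inst} {env : I → List Data} {P Q R : Prog}

/-- The environment once the trial coloring is computed. -/
def colorEnv (x : Inst) (a : Fin x.k) (χ : Fin x.n → Fin x.k) : List Data :=
  encodeColoring χ :: trialEnv x a

theorem mono {a : ∀ i, Fin (π i).k} {χ : ∀ i, Fin (π i).n → Fin (π i).k}
    {E : ∀ i, Finset (Fin (π i).n)} {s : I → Data}
    (henv : ∀ i, env i = s i :: .ofFinset (E i) :: colorEnv (π i) (a i) (χ i)) :
    Comp π .mono env fun i => bit (IsMono (χ i) (E i)) := by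
  obtain rfl : env = fun i => s i :: .ofFinset (E i) :: colorEnv (π i) (a i) (χ i) := funext henv
  refine allV (b := fun i v => v ∈ E i → ∀ u ∈ E i, χ i u = χ i v) (fun _ => rfl)
    (imp ?_ (allV (b := fun (y : Loop fun i => Fin (π i).n) u => u ∈ E y.base →
      χ y.base u = χ y.base y.elem) (fun _ => rfl) (imp ?_ (eqC ?_ ?_))))
  · exact memE (var 1 fun _ => rfl) (var 3 fun _ => rfl)
  · exact memE (π := fun z : Loop fun y : Loop fun i => Fin (π i).n => Fin (π y.base).n =>
      π z.base.base) (E := fun z => E z.base.base) (var 1 fun _ => rfl) (var 5 fun _ => rfl)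
  · exact colorAt (π := fun z : Loop fun y : Loop fun i => Fin (π i).n => Fin (π y.base).n =>
      π z.base.base) (χ := fun z => χ z.base.base) (var 1 fun _ => rfl) (var 6 fun _ => rfl)
  · exact colorAt (π := fun z : Loop fun y : Loop fun i => Fin (π i).n => Fin (π y.base).n =>
      π z.base.base) (χ := fun z => χ z.base.base) (v := fun z => z.base.elem)
      (var 3 fun _ => rfl) (var 6 fun _ => rfl)

/-- The environment once a monochromatic edge is found. -/
def branchEnv (x : Inst) (a : Fin x.k) (χ : Fin x.n → Fin x.k) (E : Finset (Fin x.n)) :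
    List Data :=
  .ofFinset E :: colorEnv x a χ

theorem childEntry {a j : ∀ i, Fin (π i).k} {χ : ∀ i, Fin (π i).n → Fin (π i).k}
    {E E' : ∀ i, Finset (Fin (π i).n)} {u v : ∀ i, Fin (π i).n} {s t t' t'' : I → Data}
    (henv : ∀ i, env i = s i :: .ofNat (j i) :: t i :: .ofNat (u i) :: t' i :: .ofFinset (E' i) ::
      t'' i :: .ofNat (v i) :: branchEnv (π i) (a i) (χ i) (E i)) :
    Comp π .childEntry env fun i => .ofBool (j i ∈ (π i).child (χ i) (v i) (E' i) (u i)) := by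
  have hc : Comp π (.eq (.var 1) (.nth (.var 7) (.var 9))) env fun i => bit (j i = χ i (v i)) :=
    eqC (var 1 fun i => by rw [henv]; rfl)
      (colorAt (var 7 fun i => by rw [henv]; rfl) (var 9 fun i => by rw [henv]; rfl))
  obtain rfl : env = _ := funext henv
  refine ((memList (c := j) (v := u) (var 1 fun _ => rfl) (var 3 fun _ => rfl)
    (var 13 fun _ => rfl)).and (ite (p := fun i => u i = v i)
    (w := fun i => bit (if u i = v i then j i ≠ χ i (v i) else u i ∈ E' i → j i = χ i (v i)))
    (eqV (var 3 fun _ => rfl) (var 7 fun _ => rfl)) hc.not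
    ((memE (v := u) (E := E') (var 3 fun _ => rfl) (var 5 fun _ => rfl)).imp hc) ?_ ?_)).congr ?_
  · intro i h
    simp [h]
  · intro i h
    simp [h]
  · intro i
    rw [← bit_eq]
    simp [Inst.child]

theorem childArg {a : ∀ i, Fin (π i).k} {χ : ∀ i, Fin (π i).n → Fin (π i).k}
    {E E' : ∀ i, Finset (Fin (π i).n)} {v : ∀ i, Fin (π i).n} {s t : I → Data}
    (henv : ∀ i, env i = s i :: .ofFinset (E' i) ::
      t i :: .ofNat (v i) :: branchEnv (π i) (a i) (χ i) (E i)) :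
    Comp π .childArg env fun i => (π i).arg ((π i).child (χ i) (v i) (E' i)) := by
  obtain rfl : env = _ := funext henv
  refine (cons (var (v := fun i => (π i).esData) 10 fun _ => rfl)
    (mapV (f := fun i u => Data.ofFinset ((π i).child (χ i) (v i) (E' i) u)) (fun _ => rfl)
      (mapC (π := fun y : Loop fun i => Fin (π i).n => π y.base)
        (f := fun y j => Data.ofBool (j ∈ (π y.base).child (χ y.base) (v y.base) (E' y.base) y.elem))
        (fun _ => rfl) ?_))).cons nil
  exact childEntry (π := fun z : Loop fun y : Loop fun i => Fin (π i).n => Fin (π y.base).k =>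
    π z.base.base) (a := fun z => a z.base.base) (χ := fun z => χ z.base.base)
    (E := fun z => E z.base.base) (E' := fun z => E' z.base.base) (u := fun z => z.base.elem)
    (v := fun z => v z.base.base) (fun _ => rfl)

theorem foldl_cons_ofList {α : Type} (f : α → Data) (l : List α) (r : List Data) :
    l.foldl (fun s x => .cons (f x) s) (Data.ofList r) = .ofList ((l.map f).reverse ++ r) := by
  induction l generalizing r with
  | nil => rfl
  | cons x l ih => simpa [Data.ofList] using ih (f x :: r)

/-- The shape of the nested loops that list the subproblems: the inner loop continues with the outer
accumulator, and prepending reverses the order. -/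
theorem foldl_foldl_cons {α β : Type} (p : α → Prop) [DecidablePred p] (f : α → β → Data)
    (l : List α) (l' : List β) (r : List Data) :
    l.foldl (fun s x => if p x then l'.foldl (fun s y => .cons (f x y) s) s else s)
      (Data.ofList r) = .ofList (((l.filter p).flatMap fun x => l'.map (f x)).reverse ++ r) := by
  induction l generalizing r with
  | nil => rfl
  | cons x l ih =>
    by_cases h : p x
    · simp only [List.foldl_cons, h, if_true, foldl_cons_ofList, ih]
      simp [h]
    · simp [h, ih]

theorem branches {a : ∀ i, Fin (π i).k} {χ : ∀ i, Fin (π i).n → Fin (π i).k}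
    {E : ∀ i, Finset (Fin (π i).n)} (henv : ∀ i, env i = branchEnv (π i) (a i) (χ i) (E i)) :
    Comp π .branches env fun i =>
      .ofList (((π i).children (χ i) (E i)).reverse.map (π i).arg) := by
  obtain rfl : env = _ := funext henv
  refine (fold (β := fun i => Fin (π i).n) (enc := fun i v => .ofNat v)
    (xs := fun i => (List.finRange (π i).n).reverse)
    (g := fun i v s => if v ∈ E i then (π i).es.foldl
      (fun s E' => .cons ((π i).arg ((π i).child (χ i) v E')) s) s else s)
    (vertexVar 4 fun _ => rfl) poly_n nil (ite (p := fun y => y.elem ∈ E y.base)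
      (memE (π := fun y : Loop fun i => Fin (π i).n => π y.base) (E := fun y => E y.base)
        (var 1 fun _ => rfl) (var 2 fun _ => rfl))
      (fold (π := fun y : Loop fun i => Fin (π i).n => π y.base)
        (β := fun y => Finset (Fin (π y.base).n)) (enc := fun _ => Data.ofFinset)
        (xs := fun y => (π y.base).es) (u := fun y => y.acc)
        (g := fun y E' s => .cons ((π y.base).arg ((π y.base).child (χ y.base) y.elem E')) s)
        (edgeVar 8 fun _ => rfl) poly_m (var 0 fun _ => rfl)
        (cons ?_ (var 0 fun _ => rfl))) (u := fun y => (π y.base).es.foldl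
      (fun s E' => .cons ((π y.base).arg ((π y.base).child (χ y.base) y.elem E')) s) y.acc)
      (v := fun y => y.acc) (var 0 fun _ => rfl) ?_ ?_)).congr ?_
  · exact childArg (π := fun z : Loop fun y : Loop fun i => Fin (π i).n => Finset (Fin (π y.base).n)
      => π z.base.base) (a := fun z => a z.base.base) (χ := fun z => χ z.base.base)
      (E := fun z => E z.base.base) (E' := fun z => z.elem)
      (v := fun z => z.base.elem) (fun _ => rfl)
  · intro y h
    simp [h]
  · intro y h
    simp [h]
  · intro i
    rw [← Data.ofList, foldl_foldl_cons]
    simp [Inst.children, List.map_reverse, List.map_flatMap, Function.comp_def]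

theorem search (hL : ∀ i v, (π i).L v ≠ ∅) (hn : ∀ i, 0 < (π i).n)
    (henv : ∀ i, env i = baseEnv (π i)) :
    ∃ w, Comp π .search env w ∧ ∀ i, (π i).Outcome (w i) := by
  classical
  obtain rfl : env = fun i => baseEnv (π i) := funext henv
  have ha : ∀ i, ∃ a : Fin (π i).k, findLast (fun v : Fin (π i).k => .ofNat v)
      (π i).IsLargest .nil (List.finRange (π i).k).reverse = .ofNat a ∧ (π i).IsLargest a := by
    intro i
    -- The nonempty list of vertex `0` supplies a color, so that a maximum over the colors exists.
    obtain ⟨c0, -⟩ := Finset.nonempty_iff_ne_empty.2 (hL i ⟨0, hn i⟩)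
    have : Nonempty (Fin (π i).k) := ⟨c0⟩
    obtain ⟨a, ha⟩ := Finite.exists_max
      fun j : Fin (π i).k => (π i).es.countP fun E => Active (π i).L j E
    rcases findLast_spec (fun v : Fin (π i).k => .ofNat v) (π i).IsLargest .nil
      (List.finRange (π i).k).reverse with ⟨b, -, hb, h⟩ | ⟨h, -⟩
    · exact ⟨b, h, hb⟩
    · exact absurd (by unfold Inst.IsLargest; convert ha) (h a (by simp))
  choose a ha1 ha2 using ha
  choose χ hχ1 hχ2 using fun i => exists_trial (π i) (a i) (hL i)
  -- The default is the code of `∅`, so that the found value codes a set of vertices even without a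
  -- monochromatic edge: the rule `ite` wants the branch analysed on all instances.
  have hE : ∀ i, ∃ E : Finset (Fin (π i).n), findLast Data.ofFinset (IsMono (χ i))
      (.ofFinset (∅ : Finset (Fin (π i).n))) (π i).es = .ofFinset E ∧ ((∃ E ∈ (π i).es, IsMono (χ i) E) → E ∈ (π i).es ∧ IsMono (χ i) E) := by
    intro i
    rcases findLast_spec Data.ofFinset (IsMono (χ i)) (.ofFinset (∅ : Finset (Fin (π i).n)))
      (π i).es with
      ⟨E, h1, h2, h⟩ | ⟨h1, h2⟩
    · exact ⟨E, h, fun _ => ⟨h1, h2⟩⟩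
    · exact ⟨∅, h2, fun ⟨E, h3, h4⟩ => absurd h4 (h1 E h3)⟩
  choose E hE1 hE2 using hE
  have hmono : Comp (fun y : Loop fun i => Finset (Fin (π i).n) => π y.base) .mono
      (fun y => y.acc :: .ofFinset y.elem :: colorEnv (π y.base) (a y.base) (χ y.base))
      fun y => bit (IsMono (χ y.base) y.elem) := mono fun _ => rfl
  refine ⟨fun i => if ∃ E ∈ (π i).es, IsMono (χ i) E then
    .cons (.cons .nil .nil) (.ofList (((π i).children (χ i) (E i)).reverse.map (π i).arg))
    else .cons .nil (encodeColoring (χ i)), bind (((largest fun _ => rfl)).congr ha1)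
    (bind (u := fun i => encodeColoring (χ i)) ((trialColor fun _ => rfl).congr fun i => ?_)
      (ite (anyE (b := fun i => IsMono (χ i)) (fun _ => rfl) hmono)
        (bind (u := fun i => .ofFinset (E i)) ((findE (b := fun i => IsMono (χ i))
          (u := fun i => .ofFinset (∅ : Finset (Fin (π i).n))) (fun _ => rfl)
          ((mapV (f := fun _ _ => .nil) (fun _ => rfl) nil).congr fun i => ?_) hmono).congr hE1)
          (tt.cons (branches fun _ => rfl)))
        (nil.cons (var 0 fun _ => rfl)) ?_ ?_)), fun i => ?_⟩
  · simp only [hχ2]; rfl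
  · simp [Data.ofFinset, Data.ofBool]
  · intro i h
    simp only [h, if_true]
  · intro i h
    simp only [h, if_false]; rfl
  · dsimp only
    split_ifs with h
    · exact .branch (a i) (χ i) (E i) (ha2 i) (hχ1 i) (hE2 i h).1 (hE2 i h).2 (hL i)
    · exact .answer (χ i) (hχ1 i).mem (by simpa using h)

theorem body : ∃ w, Comp id .body (fun x : Inst => [x.arg x.L]) w ∧ ∀ x : Inst, x.Outcome (w x) := by
  have hLs : ∀ x : Inst, x.LsData ≠ .nil ↔ 0 < x.n := by
    rintro ⟨_ | n, k, es, L⟩ <;> simp [Inst.LsData, Data.ofList]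
  have hmain : ∃ w, Comp (fun x : {x : Inst // 0 < x.n} => x.1)
      (.bind (.iota (.var 0)) <| .bind (.iota (.head (.var 1))) <| .ite .hasEmpty .nil .search)
      (fun x => [x.1.LsData, x.1.esData, x.1.arg x.1.L]) w ∧
        ∀ x : {x : Inst // 0 < x.n}, x.1.Outcome (w x) := by
    obtain ⟨w, hw, h⟩ := ite_exists (I := {x : Inst // 0 < x.n}) (π := fun x => x.1)
      (env := fun x => baseEnv x.1) (p := fun x => ∃ v, x.1.L v = ∅)
      (S := fun x => x.1.Outcome) (P := .nil) (Q := .search) (hasEmpty fun _ => rfl)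
      (fun x => bit_ne_nil)
      ⟨_, nil, fun x : {x : {x : Inst // 0 < x.n} // _} => x.2.elim fun v hv => .emptyList v hv⟩
      (search (fun x v hv => x.2 ⟨v, hv⟩) (fun x => x.1.2) fun _ => rfl)
    refine ⟨w, bind (u := fun x : {x : Inst // 0 < x.n} => x.1.vsData) ((iota
      (l := fun x => List.ofFn fun v => Data.ofFinset (x.1.L v)) (var 0 fun _ => rfl) ?_).congr fun x => ?_)
      (bind (u := fun x : {x : Inst // 0 < x.n} => x.1.csData) ((iota
      (l := fun x => List.ofFn fun c => Data.ofBool (c ∈ x.1.L ⟨0, x.2⟩)) ((head (var (v := fun x => x.1.LsData) 1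
        fun _ => rfl)).congr fun x => ?_) ?_).congr fun x => ?_) hw), h⟩
    · exact PolyIn.size.mono fun x => by simp only [List.length_ofFn, Inst.size]; omega
    · simp [Inst.vsData]
    -- The number of colors is not an explicit part of the input; it is read off as the length of
    -- the characteristic vector of the list of vertex `0`.
    · rw [Inst.LsData, Data.head_ofList]
      simp [x.2, Data.ofFinset]
    · exact PolyIn.size.mono fun x => by simp only [List.length_ofFn, Inst.size]; omega
    · simp [Inst.csData]
  have hes : ∀ x : Inst, x.esData ≠ .nil ↔ x.es ≠ [] := by
    rintro ⟨n, k, _ | ⟨E, es⟩, L⟩ <;> simp [Inst.esData, Data.ofList]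
  -- Without vertices every edge is empty and hence monochromatic, so the empty coloring is proper
  -- exactly if there are no edges.
  have hdeg := ite_exists (I := {x : Inst // ¬ 0 < x.n}) (π := fun x => x.1) (R := .var 1)
      (env := fun x => [x.1.LsData, x.1.esData, x.1.arg x.1.L])
      (S := fun x => x.1.Outcome) (P := .nil) (Q := .cons .nil .nil)
      (u := fun x => x.1.esData) (p := fun x => x.1.es ≠ []) (var 1 fun _ => rfl)
      (fun x => hes x.1) ⟨_, nil, fun x => .degenerate (by simpa using x.1.2) x.2⟩
      ⟨_, nil.cons nil, fun ⟨⟨⟨n, k, es, L⟩, h0⟩, h⟩ => by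
        obtain rfl : n = 0 := by simpa using h0
        obtain rfl : es = [] := by simpa using h
        exact .answer (fun v => v.elim0) (fun v => v.elim0) (by simp)⟩
  obtain ⟨w, hw, h⟩ := ite_exists (π := id) (S := Inst.Outcome)
    (env := fun x => [x.LsData, x.esData, x.arg x.L]) (R := .var 0) (u := fun x => x.LsData)
    (var 0 fun _ => rfl) hLs hmain hdeg
  exact ⟨w, bind (u := Inst.esData) (var (v := fun x : Inst => x.arg x.L) 0 fun _ => rfl).head.head
    (bind (u := Inst.LsData) (var (v := fun x : Inst => x.arg x.L) 1 fun _ => rfl).head.tail hw), h⟩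

end Comp

/-! ### Progress of the recursion -/

-- Counting edges that satisfy a condition

namespace List

variable {α : Type*} {p q r : α → Bool} {l : List α}

theorem countP_lt_countP {x : α} (hx : x ∈ l) (h : ∀ y, p y → q y) (hp : ¬ p x) (hq : q x) :
    l.countP p < l.countP q := by
  induction l with
  | nil => simp at hx
  | cons y l ih =>
    have hle : l.countP p ≤ l.countP q := countP_mono_left fun z _ => h z
    rcases List.mem_cons.1 hx with rfl | hx
    · simp [hp, hq]; omega
    · have := ih hx
      by_cases hy : p y
      · simp [hy, h y hy, this]
      · by_cases hy' : q y <;> simp [hy, hy'] <;> omega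

theorem countP_le_add (h : ∀ y, p y → q y ∨ r y) : l.countP p ≤ l.countP q + l.countP r := by
  induction l with
  | nil => simp
  | cons y l ih =>
    have := h y
    simp only [countP_cons]
    split_ifs <;> simp_all <;> omega

theorem countP_add_le (h : ∀ y, q y → p y) (h' : ∀ y, r y → p y) (h'' : ∀ y, q y → ¬ r y) :
    l.countP q + l.countP r ≤ l.countP p := by
  induction l with
  | nil => simp
  | cons y l ih =>
    have h1 := h y
    have h2 := h' y
    have h3 := h'' y
    simp only [countP_cons]
    split_ifs <;> simp_all <;> omega

end List

open Classical in
/-- The number of edges that could be monochromatic in color `j`. -/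
noncomputable def activeCount {n k : ℕ} (es : List (Finset (Fin n))) (L : Fin n → Finset (Fin k))
    (j : Fin k) : ℕ :=
  es.countP fun E => Active L j E

theorem activeCount_le_length {n k : ℕ} (es : List (Finset (Fin n))) (L : Fin n → Finset (Fin k))
    (j : Fin k) : activeCount es L j ≤ es.length := List.countP_le_length

namespace Inst

variable {x : Inst} {a : Fin x.k} {χ : Fin x.n → Fin x.k} {E E' : Finset (Fin x.n)} {v : Fin x.n}

theorem child_subset (u : Fin x.n) : x.child χ v E' u ⊆ x.L u := Finset.filter_subset _ _

theorem active_of_child {j : Fin x.k} {F : Finset (Fin x.n)}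
    (h : Active (x.child χ v E') j F) : Active x.L j F := fun u hu => child_subset u (h u hu)

theorem activeCount_child_le (j : Fin x.k) :
    activeCount x.es (x.child χ v E') j ≤ activeCount x.es x.L j :=
  List.countP_mono_left fun F _ h => by simpa using active_of_child (by simpa using h)

/-- The edge `E` itself is lost: `χ` gives all its vertices the color `χ v`, so it was active in it,
and `v` loses this color. -/
theorem activeCount_child_lt (hχ : x.IsTrial a χ) (hE : E ∈ x.es) (hmono : IsMono χ E)
    (hv : v ∈ E) : activeCount x.es (x.child χ v E') (χ v) < activeCount x.es x.L (χ v) := by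
  refine List.countP_lt_countP hE (fun F h => ?_) ?_ ?_
  · simpa using active_of_child (by simpa using h)
  · simp only [decide_eq_true_eq]
    intro h
    simpa [child] using h v hv
  · simp only [decide_eq_true_eq]
    intro u hu
    rw [← hmono v hv u hu]
    exact hχ.mem u

theorem two_mul_activeCount_child_le (hχ : x.IsTrial a χ) (hne : x.child χ v E' v ≠ ∅) {c : ℕ}
    (hc : (x.es.countP fun F => E' ∩ F = ∅) ≤ c) :
    2 * activeCount x.es (x.child χ v E') a ≤ activeCount x.es x.L a + 2 * c := by
  classical
  have hsum : (x.es.countP fun F => Active x.L a F ∧ v ∈ F) +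
      (x.es.countP fun F => Active x.L a F ∧ v ∉ F) ≤ activeCount x.es x.L a :=
    List.countP_add_le (by simp +contextual) (by simp +contextual) (by simp +contextual)
  by_cases hva : χ v = a
  -- By `hne` the list of `v` contained a second color, and only for such vertices does the color
  -- `a` certify frequency.
  · have hfr : x.Frequent a v := by
      obtain ⟨j, hj⟩ := Finset.nonempty_iff_ne_empty.2 hne
      rw [child, Finset.mem_filter, if_pos rfl] at hj
      exact hχ.frequent v hva j hj.1 fun h => hj.2 (h.trans hva.symm)
    have h1 : activeCount x.es (x.child χ v E') a ≤
        x.es.countP fun F => Active x.L a F ∧ v ∉ F := by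
      refine List.countP_mono_left fun F _ h => ?_
      simp only [decide_eq_true_eq] at h ⊢
      refine ⟨active_of_child h, fun hv => ?_⟩
      simpa [child, hva] using h v hv
    have h2 : (x.es.countP fun F => Active x.L a F ∧ v ∉ F) ≤
        x.es.countP fun F => Active x.L a F ∧ v ∈ F := by
      unfold Frequent at hfr
      convert hfr
    omega
  -- An edge that avoids `v` but meets `E'` has a vertex in `E' \ {v}`, where `χ v` is the only
  -- color that can be left, so it is no longer active in `a`.
  · have h1 : activeCount x.es (x.child χ v E') a ≤
        (x.es.countP fun F => Active x.L a F ∧ v ∈ F) + x.es.countP fun F => E' ∩ F = ∅ := by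
      refine List.countP_le_add fun F h => ?_
      simp only [decide_eq_true_eq] at h ⊢
      by_cases hv : v ∈ F
      · exact Or.inl ⟨active_of_child h, hv⟩
      · refine Or.inr (Finset.eq_empty_of_forall_notMem fun u hu => hva ?_)
        rw [Finset.mem_inter] at hu
        have huv : u ≠ v := by
          rintro rfl
          exact hv hu.2
        have := h u hu.2
        rw [child, Finset.mem_filter, if_neg huv] at this
        exact (this.2 hu.1).symm
    have h2 : (x.es.countP fun F => Active x.L a F ∧ v ∈ F) ≤
        x.es.countP fun F => Active x.L a F ∧ v ∉ F := by
      by_cases hav : a ∈ x.L v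
      · have := hχ.not_frequent v hva hav
        unfold Frequent at this
        have := (not_le.1 this).le
        convert this
      · refine (Nat.le_zero.2 (List.countP_eq_zero.2 fun F _ h => ?_)).trans (Nat.zero_le _)
        simp only [decide_eq_true_eq] at h
        exact hav (h.1 v h.2)
    omega

end Inst

-- The potential

/-- The part of the potential that decreases when a number drops to at most three quarters. -/
def logPotential (m : ℕ) : ℕ := if m = 0 then 0 else 1 + Nat.log 2 (m ^ 3)

theorem logPotential_mono : Monotone logPotential := by
  intro m m' h
  unfold logPotential
  split_ifs with h1 h2
  · rfl
  · omega
  · omega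
  · exact Nat.add_le_add_left (Nat.log_mono_right (Nat.pow_le_pow_left h 3)) 1

/-- The cube is there because `(3/4)^3 = 27/64` is less than `1/2`: it at least halves, so its
logarithm drops by one. The summand `1` handles the drop to `m' = 0`. -/
theorem logPotential_lt {m m' : ℕ} (h : 4 * m' ≤ 3 * m) (hm : 0 < m) :
    logPotential m' < logPotential m := by
  unfold logPotential
  rw [if_neg hm.ne']
  split_ifs with h1
  · omega
  · have h2 : 2 * m' ^ 3 ≤ m ^ 3 := by
      have := Nat.pow_le_pow_left h 3
      rw [mul_pow, mul_pow] at this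
      omega
    have h3 := Nat.log_mono_right (b := 2) h2
    rw [mul_comm, Nat.log_mul_base (by norm_num) (by positivity)] at h3
    omega

/-- A potential for a number that in each step drops to about a half, or by one if it is small. -/
def potential (c m : ℕ) : ℕ := min m (4 * c) + logPotential m

theorem potential_mono (c : ℕ) : Monotone (potential c) := fun _ _ h =>
  add_le_add (min_le_min_right _ h) (logPotential_mono h)

/-- The potential of a subproblem. -/
noncomputable def totalPotential {n k : ℕ} (c : ℕ) (es : List (Finset (Fin n)))
    (L : Fin n → Finset (Fin k)) : ℕ :=
  ∑ j, potential c (activeCount es L j)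

theorem totalPotential_le {n k : ℕ} (c : ℕ) (es : List (Finset (Fin n)))
    (L : Fin n → Finset (Fin k)) : totalPotential c es L ≤ k * potential c es.length := by
  refine (Finset.sum_le_card_nsmul _ _ (potential c es.length) fun j _ =>
    potential_mono c (activeCount_le_length es L j)).trans ?_
  simp

theorem Inst.totalPotential_child_lt {x : Inst} {a : Fin x.k} {χ : Fin x.n → Fin x.k}
    {E E' : Finset (Fin x.n)} {v : Fin x.n} {c : ℕ} (ha : x.IsLargest a) (hχ : x.IsTrial a χ)
    (hE : E ∈ x.es) (hmono : IsMono χ E) (hv : v ∈ E) (hne : x.child χ v E' v ≠ ∅)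
    (hc : (x.es.countP fun F => E' ∩ F = ∅) ≤ c) :
    totalPotential c x.es (x.child χ v E') < totalPotential c x.es x.L := by
  have hlt := activeCount_child_lt (E' := E') hχ hE hmono hv
  have hhalf := two_mul_activeCount_child_le hχ hne hc
  have hmax : activeCount x.es x.L (χ v) ≤ activeCount x.es x.L a := ha (χ v)
  have hle : ∀ j, activeCount x.es (x.child χ v E') j ≤ activeCount x.es x.L j :=
    activeCount_child_le
  refine Finset.sum_lt_sum (fun j _ => potential_mono c (hle j)) ?_
  -- From `4 * c` on, half plus `c` is at most three quarters, so the logarithmic part for `a`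
  -- drops. Below, maximality of `a` puts the count for `χ v` under `4 * c` too, where the minimum
  -- registers each lost edge.
  by_cases hbig : 4 * c ≤ activeCount x.es x.L a
  · exact ⟨a, Finset.mem_univ _, add_lt_add_of_le_of_lt (min_le_min_right _ (hle a))
      (logPotential_lt (by omega) (by omega))⟩
  · exact ⟨χ v, Finset.mem_univ _, add_lt_add_of_lt_of_le (by omega)
      (logPotential_mono (hle _))⟩

/-! ### Correctness of the recursion -/

theorem two_le_card_image_iff {n k : ℕ} (χ : Fin n → Fin k) (E : Finset (Fin n)) :
    2 ≤ (E.image χ).card ↔ ¬ IsMono χ E := by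
  rw [← not_lt, Nat.lt_succ_iff, Finset.card_le_one]
  simp only [Finset.mem_image, IsMono]
  refine not_congr ⟨fun h v hv u hu => h _ ⟨u, hu, rfl⟩ _ ⟨v, hv, rfl⟩, ?_⟩
  rintro h _ ⟨u, hu, rfl⟩ _ ⟨v, hv, rfl⟩
  exact h v hv u hu

theorem isProperListColoring_iff {n k : ℕ} (es : List (Finset (Fin n)))
    (L : Fin n → Finset (Fin k)) (χ : Fin n → Fin k) :
    IsProperListColoring es.toFinset L χ ↔ (∀ v, χ v ∈ L v) ∧ ∀ E ∈ es, ¬ IsMono χ E := by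
  simp [IsProperListColoring, two_le_card_image_iff]

/-- If there is a proper coloring, take one that uses the color of `E` most often. -/
theorem Inst.exists_child_coloring {x : Inst} {a : Fin x.k} {χ : Fin x.n → Fin x.k}
    {E : Finset (Fin x.n)} (hχ : x.IsTrial a χ) (hE : E ∈ x.es) (hmono : IsMono χ E)
    (h : ∃ ψ, IsProperListColoring x.es.toFinset x.L ψ) :
    ∃ v ∈ E, ∃ E' ∈ x.es, ∃ ψ, IsProperListColoring x.es.toFinset (x.child χ v E') ψ := by
  classical
  simp only [isProperListColoring_iff] at h ⊢
  have hne : E.Nonempty := by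
    obtain ⟨ψ, -, hψ⟩ := h
    refine Finset.nonempty_iff_ne_empty.2 fun h0 => hψ E hE ?_
    simp [h0, IsMono]
  obtain ⟨w, hw⟩ := hne
  obtain ⟨ψ, hψ, hmax⟩ := Finset.exists_max_image
    (Finset.univ.filter fun ψ : Fin x.n → Fin x.k => (∀ v, ψ v ∈ x.L v) ∧ ∀ E ∈ x.es, ¬ IsMono ψ E)
    (fun ψ => (Finset.univ.filter fun v => ψ v = χ w).card) (by simpa [Finset.Nonempty] using h)
  simp only [Finset.mem_filter, Finset.mem_univ, true_and] at hψ hmax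
  obtain ⟨v, hv, hvw⟩ : ∃ v ∈ E, ψ v ≠ χ w := by
    by_contra hcon
    push Not at hcon
    exact hψ.2 E hE fun v hv u hu => (hcon u hu).trans (hcon v hv).symm
  have hχv : χ v = χ w := hmono w hw v hv
  -- Otherwise the recolored map would be proper and use the color of `E` once more. It respects the
  -- lists because `χ v` is in the list of `v`.
  have hbad : ∃ E' ∈ x.es, IsMono (Function.update ψ v (χ w)) E' := by
    by_contra hcon
    push Not at hcon
    refine absurd (hmax (Function.update ψ v (χ w)) ⟨fun u => ?_, hcon⟩) (not_le.2 ?_)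
    · by_cases hu : u = v
      · subst hu
        simpa [← hχv] using hχ.mem u
      · simpa [hu] using hψ.1 u
    · refine Finset.card_lt_card ((Finset.ssubset_iff_of_subset fun u hu => ?_).2 ⟨v, ?_, ?_⟩)
      · simp only [Finset.mem_filter, Finset.mem_univ, true_and] at hu ⊢
        by_cases huv : u = v
        · simp [huv]
        · simpa [huv] using hu
      · simp
      · simpa using hvw
  obtain ⟨E', hE', hm⟩ := hbad
  -- Away from `v` nothing was recolored, so an `E'` without `v` would already be monochromatic in
  -- `ψ`.
  have hvE' : v ∈ E' := by
    by_contra hcon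
    refine hψ.2 E' hE' fun u hu u' hu' => ?_
    have hu1 : u ≠ v := fun e => hcon (e ▸ hu)
    have hu2 : u' ≠ v := fun e => hcon (e ▸ hu')
    simpa [hu1, hu2] using hm u hu u' hu'
  refine ⟨v, hv, E', hE', ψ, fun u => ?_, hψ.2⟩
  rw [child, Finset.mem_filter, hχv]
  refine ⟨hψ.1 u, ?_⟩
  split_ifs with huv
  · subst huv
    exact hvw
  · intro hu
    simpa [huv] using hm v hvE' u hu

theorem Inst.mem_children {x : Inst} {χ : Fin x.n → Fin x.k} {E : Finset (Fin x.n)}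
    {L' : Fin x.n → Finset (Fin x.k)} :
    L' ∈ x.children χ E ↔ ∃ v ∈ E, ∃ E' ∈ x.es, x.child χ v E' = L' := by
  simp [children]

theorem Inst.length_children_le (x : Inst) (χ : Fin x.n → Fin x.k) (E : Finset (Fin x.n)) :
    (x.children χ E).length ≤ x.n * x.es.length := by
  simp only [children, List.length_flatMap, List.length_map, List.map_const', List.sum_replicate,
    smul_eq_mul]
  refine Nat.mul_le_mul_right _ ((List.length_filter_le _ _).trans ?_)
  simp

-- Running the recursion

/-- A solution stems from one of the calls, whereas `none` means that all of them were made and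
failed; the costs add up in time and are maximized in depth and in time per call. -/
theorem exists_tryAll {α : Type*} (p : Prog) (f : α → Data) (S : α → Option Data → Prop)
    (t d w : ℕ) (l : List α)
    (h : ∀ y ∈ l, ∃ r c, Call p (f y) r c ∧ S y r ∧ c.time ≤ t ∧ c.depth ≤ d ∧ c.nodeTime ≤ w) :
    ∃ r c, TryAll p (l.map f) r c ∧ (∀ s, r = some s → ∃ y ∈ l, S y (some s)) ∧
      (r = none → ∀ y ∈ l, S y none) ∧ c.time ≤ l.length * t ∧ c.depth ≤ d + 1 ∧
      c.nodeTime ≤ w := by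
  induction l with
  | nil => exact ⟨_, _, .nil, by simp⟩
  | cons y l ih =>
    obtain ⟨r, c, hc, hS, h1, h2, h3⟩ := h y (by simp)
    have hlen : (y :: l).length * t = t + l.length * t := by
      rw [List.length_cons]; ring
    cases r with
    | some s =>
      refine ⟨_, _, .found (f y) (l.map f) s c hc, fun s' hs' => ⟨y, by simp, hs' ▸ hS⟩, by simp,
        ?_, ?_, h3⟩
      · rw [hlen]; exact h1.trans (Nat.le_add_right _ _)
      · exact Nat.succ_le_succ h2
    | none =>
      obtain ⟨r, c', hc', hsome, hnone, h1', h2', h3'⟩ := ih fun y hy => h y (by simp [hy])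
      refine ⟨_, _, .next (f y) (l.map f) r c c' hc hc', fun s hs => ?_, fun hr => ?_, ?_, ?_,
        max_le h3 h3'⟩
      · obtain ⟨y', hy', hS'⟩ := hsome s hs
        exact ⟨y', by simp [hy'], hS'⟩
      · simpa [hS] using hnone hr
      · rw [hlen]; exact add_le_add h1 h1'
      · exact max_le (Nat.succ_le_succ h2) h2'

open Classical in
/-- A bound for the height of the recursion tree of a subproblem. -/
noncomputable def depthBound {n k : ℕ} (c : ℕ) (es : List (Finset (Fin n)))
    (L : Fin n → Finset (Fin k)) : ℕ :=
  if ∃ v, L v = ∅ then 0 else totalPotential c es L + 1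

/-- The recursion solves the problem, at a cost that is controlled by the potential. -/
theorem exists_call {n k c w : ℕ} (es : List (Finset (Fin n)))
    (hc : ∀ E ∈ es, (es.countP fun F => E ∩ F = ∅) ≤ c)
    (hw : ∀ L : Fin n → Finset (Fin k),
      (Prog.body.eval [.cons (encodeInput es L) .nil]).2 + 1 + n * es.length ≤ w)
    (L : Fin n → Finset (Fin k)) :
    ∃ r cost, Call .body (.cons (encodeInput es L) .nil) r cost ∧
      IsCorrectResult es.toFinset L r ∧
      cost.time ≤ w * (n * es.length + 1) ^ depthBound c es L ∧
      cost.depth ≤ depthBound c es L ∧ cost.nodeTime ≤ w := by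
  -- The edges stay fixed along the recursion and only the lists change, so `c` and `w` serve all
  -- subproblems.
  induction hd : depthBound c es L using Nat.strong_induction_on generalizing L with
  | _ d ih =>
  have hwL := hw L
  have hpos : ∀ e, w ≤ w * (n * es.length + 1) ^ e := fun e =>
    Nat.le_mul_of_pos_right _ (by positivity)
  have hbody : (⟨n, k, es, L⟩ : Inst).Outcome
      (Prog.body.eval [.cons (encodeInput es L) .nil]).1 := by
    obtain ⟨val, hval, hout⟩ := Comp.body
    have := hout ⟨n, k, es, L⟩
    rwa [← hval.value] at this
  have hleaf (h : (Prog.body.eval [.cons (encodeInput es L) .nil]).1 = .nil)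
      (hno : ¬ ∃ χ, IsProperListColoring es.toFinset L χ) :
      ∃ r cost, Call .body (.cons (encodeInput es L) .nil) r cost ∧
        IsCorrectResult es.toFinset L r ∧ cost.time ≤ w * (n * es.length + 1) ^ d ∧
        cost.depth ≤ d ∧ cost.nodeTime ≤ w := by
    refine ⟨none, _, .branch _ [] none _ (by rw [h]; rfl) .nil, hno, ?_, Nat.zero_le _, ?_⟩
    · refine le_trans ?_ (hpos d)
      simp only [List.length_nil]; omega
    · simp only [List.length_nil]; omega
  generalize hv : (Prog.body.eval [.cons (encodeInput es L) .nil]).1 = val at hbody hleaf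
  cases hbody with
  | degenerate h0 hes =>
    dsimp only at h0 hes
    refine hleaf rfl ?_
    subst h0
    obtain ⟨E, hE⟩ := List.exists_mem_of_ne_nil _ hes
    rintro ⟨χ, hχ⟩
    exact ((isProperListColoring_iff es L χ).1 hχ).2 E hE fun v => v.elim0
  | emptyList v hv =>
    refine hleaf rfl ?_
    rintro ⟨χ, hχ⟩
    have := hχ.1 v
    simp_all
  | answer χ hmem h =>
    refine ⟨_, _, .answer _ (encodeColoring χ) (by rw [hv]; rfl),
      ⟨χ, (isProperListColoring_iff es L χ).2 ⟨hmem, h⟩, rfl⟩, ?_, Nat.zero_le _, ?_⟩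
    · exact le_trans (by dsimp only; omega) (hpos d)
    · dsimp only; omega
  | branch a χ E ha hχ hE hmono hL =>
    dsimp only at a χ E hE hL
    set x : Inst := ⟨n, k, es, L⟩ with hx
    have hdL : d = totalPotential c es L + 1 := by
      rw [← hd, depthBound, if_neg (by simpa using hL)]
    have hchild : ∀ L' ∈ x.children χ E, depthBound c es L' < d := by
      intro L' hL'
      obtain ⟨v, hv, E', hE', rfl⟩ := Inst.mem_children.1 hL'
      rw [depthBound]
      -- An empty list makes the subproblem a leaf; otherwise the list of `v` is nonempty, as the
      -- decrease of the potential requires.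
      split_ifs with hem
      · omega
      · have := Inst.totalPotential_child_lt (c := c) ha hχ hE hmono hv
          (fun h0 => hem ⟨v, h0⟩) (hc E' hE')
        exact lt_of_lt_of_eq (Nat.succ_lt_succ this) hdL.symm
    obtain ⟨r, cost, htry, hsome, hnone, h1, h2, h3⟩ := exists_tryAll .body x.arg
      (fun L' r => IsCorrectResult es.toFinset L' r)
      (w * (n * es.length + 1) ^ (d - 1)) (d - 1) w (x.children χ E).reverse (by
        intro L' hL'
        rw [List.mem_reverse] at hL'
        have hlt := hchild L' hL'
        obtain ⟨r, cost, hcall, hcorr, h1, h2, h3⟩ := ih _ hlt L' rfl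
        refine ⟨r, cost, hcall, hcorr, h1.trans ?_, by omega, h3⟩
        exact Nat.mul_le_mul_left _ (Nat.pow_le_pow_right (Nat.succ_pos _) (by omega)))
    have hlen : (x.children χ E).reverse.length ≤ n * es.length := by
      rw [List.length_reverse]
      exact x.length_children_le χ E
    have hlen' : ((x.children χ E).reverse.map x.arg).length ≤ n * es.length := by
      rwa [List.length_map]
    refine ⟨r, _, .branch _ ((x.children χ E).reverse.map x.arg) r cost
      (by rw [hv]; exact congrArg CallAction.branch (Data.spine_ofList _)) htry, ?_, ?_, ?_, ?_⟩
    · cases r with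
      | some s =>
        obtain ⟨L', hL', ψ, hψ, hs⟩ := hsome s rfl
        obtain ⟨v, hv, E', hE', rfl⟩ := Inst.mem_children.1 (List.mem_reverse.1 hL')
        exact ⟨ψ, ⟨fun u => Inst.child_subset (x := x) u (hψ.1 u), hψ.2⟩, hs⟩
      | none =>
        intro hex
        obtain ⟨v, hv, E', hE', hex'⟩ := Inst.exists_child_coloring hχ hE hmono hex
        exact hnone rfl _ (List.mem_reverse.2 (Inst.mem_children.2 ⟨v, hv, E', hE', rfl⟩)) hex'
    · have h4 : cost.time ≤ n * es.length * (w * (n * es.length + 1) ^ (d - 1)) :=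
        h1.trans (Nat.mul_le_mul_right _ hlen)
      -- The `+ 1` in the base yields the second summand, which is at least `w` and pays for the
      -- call itself.
      have h5 : w * (n * es.length + 1) ^ d =
          n * es.length * (w * (n * es.length + 1) ^ (d - 1)) +
            w * (n * es.length + 1) ^ (d - 1) := by
        obtain ⟨e, rfl⟩ : ∃ e, d = e + 1 := ⟨_, hdL⟩
        rw [Nat.add_sub_cancel]; ring
      have := hpos (d - 1)
      dsimp only
      omega
    · exact h2.trans (by omega)
    · exact max_le (by omega) h3

/-! ### Growth rates -/

theorem logPotential_le (m : ℕ) : logPotential m ≤ 4 + 3 * Nat.log 2 m := by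
  unfold logPotential
  split_ifs with h
  · omega
  · have h1 : m ^ 3 < 2 ^ (3 * (Nat.log 2 m + 1)) := by
      rw [mul_comm, pow_mul]
      exact Nat.pow_lt_pow_left (Nat.lt_pow_succ_log_self (by norm_num) m) (by norm_num)
    have := Nat.log_lt_of_lt_pow (by positivity) h1
    omega

theorem one_le_log (m n : ℕ) : 1 ≤ Nat.log 2 (m + n + 2) :=
  Nat.log_pos (by norm_num) (by omega)

theorem isPolylogBounded_depth {c : ℕ → ℕ → ℕ} (hc : IsPolylogBounded c) (k : ℕ) :
    IsPolylogBounded fun m n => k * potential (c m n) m + 1 := by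
  obtain ⟨C, a, hC⟩ := hc
  -- The minimum contributes `4 * C`, the logarithmic part `4 + 3` since the logarithm is at least
  -- one, and the last `+ 1` is the leaf level.
  refine ⟨k * (4 * C + 7) + 1, a + 1, fun m n => ?_⟩
  have hl := one_le_log m n
  have hlog : Nat.log 2 m ≤ Nat.log 2 (m + n + 2) := Nat.log_mono_right (by omega)
  have hCmn := hC m n
  generalize Nat.log 2 (m + n + 2) = ℓ at *
  have h1 : ℓ ^ a ≤ ℓ ^ (a + 1) := Nat.pow_le_pow_right hl (by omega)
  have h2 : ℓ ≤ ℓ ^ (a + 1) := Nat.le_self_pow (by omega) ℓ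
  have h3 : potential (c m n) m ≤ (4 * C + 7) * ℓ ^ (a + 1) := by
    have h4 := logPotential_le m
    have h5 : c m n ≤ C * ℓ ^ (a + 1) := hCmn.trans (Nat.mul_le_mul_left _ h1)
    have h6 : min m (4 * c m n) ≤ 4 * c m n := min_le_right _ _
    unfold potential
    nlinarith
  have h4 := Nat.mul_le_mul_left k h3
  nlinarith

theorem isQuasiPolyBounded_time {W D : ℕ → ℕ → ℕ} (hW : IsPolyBounded W)
    (hD : IsPolylogBounded D) : IsQuasiPolyBounded fun m n => W m n * (n * m + 1) ^ D m n := by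
  obtain ⟨C, a, hC⟩ := hW
  obtain ⟨C', a', hC'⟩ := hD
  -- Everything becomes a power of two: `C ≤ 2 ^ C`, `m + n + 2 ≤ 2 ^ (2 * ℓ)` (doubled because the
  -- logarithm is rounded down), and `n * m + 1 ≤ 2 ^ (4 * ℓ)`, raised to the depth.
  refine ⟨C + 2 * a + 4 * C', a' + 1, fun m n => ?_⟩
  have hl := one_le_log m n
  have hlt : m + n + 2 ≤ 2 ^ (2 * Nat.log 2 (m + n + 2)) :=
    (Nat.lt_pow_succ_log_self (by norm_num) _).le.trans
      (Nat.pow_le_pow_right (by norm_num) (by omega))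
  have h1 := hC m n
  have h2 := hC' m n
  generalize Nat.log 2 (m + n + 2) = ℓ at *
  have h3 : n * m + 1 ≤ 2 ^ (4 * ℓ) :=
    calc n * m + 1 ≤ (m + n + 2) * (m + n + 2) := by nlinarith
      _ ≤ 2 ^ (2 * ℓ) * 2 ^ (2 * ℓ) := Nat.mul_le_mul hlt hlt
      _ = 2 ^ (4 * ℓ) := by rw [← pow_add]; congr 1; omega
  have h4 : ℓ ^ a' ≤ ℓ ^ (a' + 1) := Nat.pow_le_pow_right hl (by omega)
  have h5 : ℓ ≤ ℓ ^ (a' + 1) := Nat.le_self_pow (by omega) ℓ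
  calc W m n * (n * m + 1) ^ D m n
      ≤ C * (m + n + 2) ^ a * (n * m + 1) ^ (C' * ℓ ^ a') :=
        Nat.mul_le_mul h1 (Nat.pow_le_pow_right (Nat.succ_pos _) h2)
    _ ≤ 2 ^ C * (2 ^ (2 * ℓ)) ^ a * (2 ^ (4 * ℓ)) ^ (C' * ℓ ^ a') := by
        gcongr
        exact Nat.lt_two_pow_self.le
    _ = 2 ^ (C + 2 * a * ℓ + 4 * C' * ℓ ^ (a' + 1)) := by
        rw [← pow_mul, ← pow_mul, ← pow_add, ← pow_add]
        congr 1
        ring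
    _ ≤ 2 ^ ((C + 2 * a + 4 * C') * ℓ ^ (a' + 1)) := by
        refine Nat.pow_le_pow_right (by norm_num) ?_
        have h6 : 1 ≤ ℓ ^ (a' + 1) := Nat.one_le_pow _ _ hl
        nlinarith [Nat.mul_le_mul_left (2 * a) h5, Nat.mul_le_mul_left C h6]

theorem isPolyBounded_nodeTime (C a k : ℕ) :
    IsPolyBounded fun m n => C * (n + k + m + 1) ^ a + 1 + n * m := by
  refine ⟨C * (k + 1) ^ a + 2, a + 2, fun m n => ?_⟩
  have h1 : n + k + m + 1 ≤ (k + 1) * (m + n + 2) := by nlinarith [Nat.zero_le (k * (m + n))]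
  have h2 : (m + n + 2) ^ a ≤ (m + n + 2) ^ (a + 2) := Nat.pow_le_pow_right (by omega) (by omega)
  have h3 : (m + n + 2) ^ 2 ≤ (m + n + 2) ^ (a + 2) := Nat.pow_le_pow_right (by omega) (by omega)
  calc C * (n + k + m + 1) ^ a + 1 + n * m
      ≤ C * ((k + 1) * (m + n + 2)) ^ a + 2 * (m + n + 2) ^ 2 := by
        have := Nat.mul_le_mul_left C (Nat.pow_le_pow_left h1 a)
        nlinarith
    _ = C * (k + 1) ^ a * (m + n + 2) ^ a + 2 * (m + n + 2) ^ 2 := by rw [mul_pow]; ring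
    _ ≤ C * (k + 1) ^ a * (m + n + 2) ^ (a + 2) + 2 * (m + n + 2) ^ (a + 2) := by gcongr
    _ = _ := by ring

/-- As `es` has no repetitions, counting list positions is counting edges. -/
theorem countP_le_of_isCIntersecting {n c : ℕ} {es : List (Finset (Fin n))} (hes : es.Nodup)
    (h : IsCIntersecting c es.toFinset) (E : Finset (Fin n)) (hE : E ∈ es) :
    (es.countP fun F => E ∩ F = ∅) ≤ c := by
  refine le_trans (le_of_eq ?_) (h E (by simpa using hE))
  rw [List.countP_eq_length_filter, ← List.toFinset_card_of_nodup (hes.filter _),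
    List.toFinset_filter]
  simp

/-- One recursive procedure solves the problem. For every fixed number `k` of colors and every
polylogarithmic `c`, on all `c(m,n)`-intersecting hypergraphs with `n` vertices and `m` edges, its
running time is quasi-polynomial and its recursion tree has polylogarithmic depth, where every
single call takes polynomial time outside its recursive calls. -/
theorem theorem1 :
    ∃ p : Prog, ∀ (k : ℕ) (c : ℕ → ℕ → ℕ), IsPolylogBounded c →
      ∃ T D W : ℕ → ℕ → ℕ, IsQuasiPolyBounded T ∧ IsPolylogBounded D ∧ IsPolyBounded W ∧
        ∀ (n m : ℕ) (H : Finset (Finset (Fin n))) (L : Fin n → Finset (Fin k)),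
          H.card = m → IsCIntersecting (c m n) H →
          ∀ es : List (Finset (Fin n)), es.Nodup → es.toFinset = H →
            ∃ (r : Option Data) (cost : Cost),
              Call p (.cons (encodeInput es L) .nil) r cost ∧
              IsCorrectResult H L r ∧
              cost.time ≤ T m n ∧ cost.depth ≤ D m n ∧ cost.nodeTime ≤ W m n := by
  obtain ⟨val, hval, -⟩ := Comp.body
  -- These constants are fixed before `k` and `c`: the size of an instance includes `k`, so one time
  -- bound covers all numbers of colors.
  obtain ⟨C, a, hC⟩ := hval.time
  refine ⟨.body, fun k c hc => ?_⟩
  have hD := isPolylogBounded_depth hc k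
  have hW := isPolyBounded_nodeTime C a k
  refine ⟨_, _, _, isQuasiPolyBounded_time hW hD, hD, hW, ?_⟩
  rintro n m H L hm hH es hes rfl
  rw [List.toFinset_card_of_nodup hes] at hm
  subst hm
  obtain ⟨r, cost, hcall, hcorr, h1, h2, h3⟩ := exists_call
    (w := C * (n + k + es.length + 1) ^ a + 1 + n * es.length) es
    (countP_le_of_isCIntersecting hes hH)
    (fun L => Nat.add_le_add_right (Nat.add_le_add_right (hC ⟨n, k, es, L⟩) 1) _) L
  have hdepth : depthBound (c es.length n) es L ≤ k * potential (c es.length n) es.length + 1 := by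
    rw [depthBound]
    split_ifs
    · omega
    · exact Nat.succ_le_succ (totalPotential_le _ es L)
  exact ⟨r, cost, hcall, hcorr, h1.trans (Nat.mul_le_mul_left _
    (Nat.pow_le_pow_right (Nat.succ_pos _) hdepth)), h2.trans hdepth, h3⟩
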